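/- Let $D=\frac{d}{dt}$, let $N\in\mathbb R^{g\times m}[\xi]$, $P\in\mathbb R^{g\times g}[\xi]$, and let $\mathcal B$ be the set of all $w=(u,y)\in C^\infty(\mathbb R,\mathbb R^m\times\mathbb R^g)$ with $P(D)y=N(D)u$. Assume that this representation is minimal (no system of fewer than $g$ linear constant-coefficient differential equations has the same set $\mathcal B$ of smooth solutions) and that $\mathcal B$ is controllable (for all $w_1,w_2\in\mathcal B$ there are $\tau\ge 0$ and $w\in\mathcal B$ with $w(t)=w_1(t)$ for $t\le 0$ and $w(t)=w_2(t-\tau)$ for $t\ge\tau$). Let $\mathcal O=p(D)$ with $p\in\mathbb R[\xi]$, and let $\mathcal T=\{w\in\mathcal B:\mathcal Ow=0\}$ be the associated type; $\mathcal O$ acts componentwise on vector signals, and $\mathcal O^u,\mathcal O^y$ denote its action on $u$ and on $y$. Let $W^u=\sum_i\rho^u_i\xi^i$ and $W^y=\sum_i\rho^y_i\xi^i$ be real polynomials with nonnegative coefficients (for instance $W^u=W^y$), let $\mathcal Q^u=W^u(-D^2)$ and $\mathcal Q^y=W^y(-D^2)$ be the corresponding self-adjoint operators, let $a<b$, and let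 $$J(u,y)=\sum_i\rho^u_i\int_a^b|D^i\mathcal O^uu|^2\,dt+\sum_i\rho^y_i\int_a^b|D^i\mathcal O^yy|^2\,dt$$ be the squared Sobolev norm of $\mathcal Ow$ on $[a,b]$. For a polynomial matrix put $R^*(s)=R(-s)^T$. Fix for every component $j$ of $w=(u,y)$ a contact order $r_j\in\{0,1,2,\dots,\infty\}$. We say that $v$ and $w$ have contact of order $r$ at time $c$ if $v_j^{(k)}(c)=w_j^{(k)}(c)$ for all $j$ and all integers $0\le k\le r_j$. For $w_1,w_2\in\mathcal T$, an optimal raccordation of $w_1$ to $w_2$ (of order $r$) is a function $w$ that equals $w_1$ on $(-\infty,a]$, equals $w_2$ on $[b,\infty)$, and equals on $[a,b]$ some $v\in\mathcal B$ which minimizes $J$ among all elements of $\mathcal B$ that have contact of order $r$ with $w_1$ at $a$ and with $w_2$ at $b$. The Gluskabi extension of $\mathcal T$ (of order $r$) is the set of all optimal raccordations of elements of $\mathcal T$. **Theorem (Dynamical Raccordation).** There is a unimodular matrix $U=\begin{bmatrix}U_{11}&U_{12}\\U_{21}&U_{22}\end{bmatrix}\in\mathbb R^{(m+g)\times(m+g)}[\xi]$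 (row blocks of sizes $m,g$, column blocks of sizes $g,m$) with $\begin{bmatrix}N&P\end{bmatrix}U=\begin{bmatrix}I&0\end{bmatrix}$. For every such $U$ the following holds. (i) For every $r$ and every $w=(u,y)$ in the Gluskabi extension of order $r$ there is $\eta\in C^\infty(\mathbb R,\mathbb R^m)$ such that on $[a,b]$ $$\left(U_{12}^*\,\mathcal O^{u*}\mathcal Q^u\mathcal O^u\,U_{12}+U_{22}^*\,\mathcal O^{y*}\mathcal Q^y\mathcal O^y\,U_{22}\right)(D)\,\eta=0,\qquad u=-U_{12}(D)\eta,\qquad y=U_{22}(D)\eta .$$ (ii) Suppose that the contact order prescribes all boundary data that occur in the integrations by parts, that is, $r_j+1\ge\deg p+\deg W^u$ and $r_j+1\ge\deg N_{ij}$ (all $i$) for every component $j$ of $u$, and $r_j+1\ge\deg p+\deg W^y$ and $r_j+1\ge\deg P_{ij}$ (all $i$) for every component $j$ of $y$ (with the convention $\deg 0=0$). Then, for all $w_1,w_2\in\mathcal T$, a function $w$ that equals $w_1$ on $(-\infty,a]$ and $w_2$ on $[b,\infty)$ is an optimal raccordation of $w_1$ to $w_2$ if and only if there is $\eta\in C^\infty(\mathbb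 R,\mathbb R^m)$ that satisfies the equations in (i) on $[a,b]$, and for which $(-U_{12}(D)\eta,\,U_{22}(D)\eta)$ has contact of order $r$ with $w_1$ at $a$ and with $w_2$ at $b$. -/

import Mathlib

open Polynomial Set
open scoped ContDiff

namespace Gluskabi

noncomputable section

/-- The scalar differential operator `p(D)`, `D = d/dt`, for a real polynomial `p`. -/
def polyD (p : ℝ[X]) (f : ℝ → ℝ) : ℝ → ℝ :=
  fun t => p.sum fun k c => c * iteratedDeriv k f t

/-- The matrix differential operator `R(D)` for a real polynomial matrix `R`. -/
def matD {κ ι : Type} [Fintype ι] (R : Matrix κ ι ℝ[X]) (w : ℝ → ι → ℝ) : ℝ → κ → ℝ :=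
  fun t i => ∑ j, polyD (R i j) (fun s => w s j) t

/-- The smooth behavior of the system of differential equations `R(D) w = 0`. -/
def behavior {κ ι : Type} [Fintype ι] (R : Matrix κ ι ℝ[X]) : Set (ℝ → ι → ℝ) :=
  {w | ContDiff ℝ ∞ w ∧ ∀ t, matD R w t = 0}

/-- `R(D) w = 0` is a minimal representation: every system of differential equations with the
same behavior has at least as many rows. -/
def IsMinimalRep {κ ι : Type} [Fintype κ] [Fintype ι] (R : Matrix κ ι ℝ[X]) : Prop :=
  ∀ (k : ℕ) (R' : Matrix (Fin k) ι ℝ[X]), behavior R' = behavior R → Fintype.card κ ≤ k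

/-- Controllability of a behavior: one can switch from any of its trajectories to any other one,
perhaps with a delay. -/
def IsControllable {ι : Type} (B : Set (ℝ → ι → ℝ)) : Prop :=
  ∀ w₁ ∈ B, ∀ w₂ ∈ B, ∃ τ : ℝ, 0 ≤ τ ∧ ∃ w ∈ B,
    (∀ t, t ≤ 0 → w t = w₁ t) ∧ ∀ t, τ ≤ t → w t = w₂ (t - τ)

/-- The kernel matrix `[-N  P]` of the system `P(D) y = N(D) u`, for `w = (u, y)`. -/
def sysMatrix {m g : ℕ} (N : Matrix (Fin g) (Fin m) ℝ[X]) (P : Matrix (Fin g) (Fin g) ℝ[X]) :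
    Matrix (Fin g) (Fin m ⊕ Fin g) ℝ[X] :=
  Matrix.fromCols (-N) P

/-- The input component `u` of `w = (u, y)`. -/
def input {m g : ℕ} (w : ℝ → (Fin m ⊕ Fin g) → ℝ) : ℝ → Fin m → ℝ :=
  fun t i => w t (Sum.inl i)

/-- The output component `y` of `w = (u, y)`. -/
def output {m g : ℕ} (w : ℝ → (Fin m ⊕ Fin g) → ℝ) : ℝ → Fin g → ℝ :=
  fun t i => w t (Sum.inr i)

/-- The extension of a scalar operator `p(D)` to vector signals, applied in each component. -/
def extOp (ι : Type) [DecidableEq ι] (p : ℝ[X]) : Matrix ι ι ℝ[X] :=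
  p • (1 : Matrix ι ι ℝ[X])

/-- The adjoint `R^*(s) = R(-s)^T` of a polynomial matrix, so `R^*(D)` is the formal adjoint of
`R(D)`. -/
def adj {κ ι : Type} (R : Matrix κ ι ℝ[X]) : Matrix ι κ ℝ[X] :=
  (R.map fun q => q.comp (-X)).transpose

/-- The type: the trajectories `w` in the base behavior `B` with `p(D) w = 0`. -/
def typeOf {ι : Type} [Fintype ι] [DecidableEq ι] (B : Set (ℝ → ι → ℝ)) (p : ℝ[X]) :
    Set (ℝ → ι → ℝ) :=
  {w | w ∈ B ∧ ∀ t, matD (extOp ι p) w t = 0}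

/-- The operator `Q = W(-D²)` of the Sobolev norm with weight polynomial `W`. -/
def sobolevOp (W : ℝ[X]) : ℝ[X] := W.comp (-X ^ 2)

/-- The squared Sobolev norm on `[a, b]` with weight polynomial `W = ∑ᵢ ρᵢ ξ^i`, that is
`∑ᵢ ρᵢ ∫ |D^i e|²`. -/
def sobolevSq {ι : Type} [Fintype ι] (W : ℝ[X]) (a b : ℝ) (e : ℝ → ι → ℝ) : ℝ :=
  W.sum fun i ρ => ρ * ∫ t in a..b, ∑ j, (iteratedDeriv i (fun s => e s j) t) ^ 2

/-- The squared norm of the equation error `p(D) w` of `w = (u, y)` on `[a, b]`. -/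
def cost {m g : ℕ} (p Wu Wy : ℝ[X]) (a b : ℝ) (w : ℝ → (Fin m ⊕ Fin g) → ℝ) : ℝ :=
  sobolevSq Wu a b (matD (extOp (Fin m) p) (input w)) +
    sobolevSq Wy a b (matD (extOp (Fin g) p) (output w))

/-- The trajectories `v` and `w` have contact of order `r j` at time `c` in each component `j`. -/
def Contact {ι : Type} (r : ι → ℕ∞) (c : ℝ) (v w : ℝ → ι → ℝ) : Prop :=
  ∀ (j : ι) (k : ℕ), (k : ℕ∞) ≤ r j →
    iteratedDeriv k (fun s => v s j) c = iteratedDeriv k (fun s => w s j) c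

/-- The trajectories in the base behavior `B` that continue `w₁` at time `a` and are continued by
`w₂` at time `b`, with contact orders `r`. -/
def connections {ι : Type} (B : Set (ℝ → ι → ℝ)) (r : ι → ℕ∞) (a b : ℝ) (w₁ w₂ : ℝ → ι → ℝ) :
    Set (ℝ → ι → ℝ) :=
  {v | v ∈ B ∧ Contact r a v w₁ ∧ Contact r b v w₂}

/-- The optimal connections of `w₁` to `w₂`: they are `w₁` up to time `a`, `w₂` from time `b` on,
and on `[a, b]` a trajectory of `B` of minimal cost `J` among all connecting ones. -/
def raccordations {ι : Type} (B : Set (ℝ → ι → ℝ)) (J : (ℝ → ι → ℝ) → ℝ) (r : ι → ℕ∞) (a b : ℝ)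
    (w₁ w₂ : ℝ → ι → ℝ) : Set (ℝ → ι → ℝ) :=
  {w | EqOn w w₁ (Iic a) ∧ EqOn w w₂ (Ici b) ∧
    ∃ v ∈ connections B r a b w₁ w₂, EqOn w v (Icc a b) ∧
      ∀ v' ∈ connections B r a b w₁ w₂, J v ≤ J v'}

/-- The Gluskabi extension of the type `T`: all optimal connections of two elements of `T`. -/
def gluskabiExtension {ι : Type} (B T : Set (ℝ → ι → ℝ)) (J : (ℝ → ι → ℝ) → ℝ) (r : ι → ℕ∞)
    (a b : ℝ) : Set (ℝ → ι → ℝ) :=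
  {w | ∃ w₁ ∈ T, ∃ w₂ ∈ T, w ∈ raccordations B J r a b w₁ w₂}

/-- `U` is unimodular and `[N  P] U = [I  O]`. The rows of `U` are split as `(u, y)`, its columns
as the first `g` and the last `m` ones. -/
def IsReducing {m g : ℕ} (N : Matrix (Fin g) (Fin m) ℝ[X]) (P : Matrix (Fin g) (Fin g) ℝ[X])
    (U : Matrix (Fin m ⊕ Fin g) (Fin g ⊕ Fin m) ℝ[X]) : Prop :=
  (∃ V : Matrix (Fin g ⊕ Fin m) (Fin m ⊕ Fin g) ℝ[X], U * V = 1 ∧ V * U = 1) ∧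
    Matrix.fromCols N P * U = Matrix.fromCols 1 0

/-- `U₁₂^* O^{u*} Q^u O^u U₁₂ + U₂₂^* O^{y*} Q^y O^y U₂₂`, with `O = p(D)`. -/
def optMatrix {m g : ℕ} (p Wu Wy : ℝ[X]) (U : Matrix (Fin m ⊕ Fin g) (Fin g ⊕ Fin m) ℝ[X]) :
    Matrix (Fin m) (Fin m) ℝ[X] :=
  adj U.toBlocks₁₂ * adj (extOp (Fin m) p) * extOp (Fin m) (sobolevOp Wu) * extOp (Fin m) p *
      U.toBlocks₁₂ +
    adj U.toBlocks₂₂ * adj (extOp (Fin g) p) * extOp (Fin g) (sobolevOp Wy) * extOp (Fin g) p *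
      U.toBlocks₂₂

/-- The trajectory `(u, y)` with `u = -U₁₂(D) η` and `y = U₂₂(D) η`. -/
def imageTraj {m g : ℕ} (U : Matrix (Fin m ⊕ Fin g) (Fin g ⊕ Fin m) ℝ[X])
    (η : ℝ → Fin m → ℝ) : ℝ → (Fin m ⊕ Fin g) → ℝ :=
  fun t => Sum.elim (-(matD U.toBlocks₁₂ η t)) (matD U.toBlocks₂₂ η t)

end

end Gluskabi

open Gluskabi

/-!
The matrix `R = [-N P]` describes the behavior `B` as the kernel of `R(D)`. Minimality and
controllability give `R` a unimodular completion. By the Smith normal form of the row module of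
`R`, this amounts to two facts: the row module has rank `g`, since any basis of it represents the
same behavior, and its elementary divisors are units. A nonconstant elementary divisor `q` would
have a complex root `z`, hence there would be a trajectory with a coordinate `Re e^{zt}` that
satisfies the autonomous equation `q(D) ψ = 0`, and such a trajectory cannot be steered to zero
(`isUnit_of_isControllable`, `exists_isReducing`).

For a reducing matrix `U` put `M = [-U₁₂; U₂₂]`. The relation `U U⁻¹ = 1` says that `R M = 0` and
`Y R + M L = 1` for some polynomial matrices `Y`, `L` (`IsExactPair`). Hence `B` is the image of
`M(D)`. The cost `J` is a positive semidefinite quadratic form on `B`, so that a trajectory is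
optimal if and only if the polar form vanishes against all admissible variations.

* Necessity (`IsExactPair.euler_eq_of_minimal`). The variations `M(D) δ`, with `δ` flat at `a` and
  `b`, are admissible for every contact order. Integration by parts and the fundamental lemma of
  the calculus of variations turn stationarity into `(M^* K M)(D) η = 0` on `[a, b]`, where `K` is
  the diagonal matrix of the operators `p(-D) W(-D²) p(D)`; the matrix `M^* K M` is `optMatrix`.
* Sufficiency (`IsExactPair.energy_eq_zero`, `IsExactPair.minimal_of_euler_eq`). An admissible
  variation `d` in `B` vanishes at `a` and `b` to the prescribed order, but a signal `ζ` with
  `d = M(D) ζ` need not. For `z = (K M)(D) η`, the adjoint relation `R^* Y^* + L^* M^* = 1`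
  together with `M^*(D) z = 0` gives `z = R^*(D) λ` with `λ = Y^*(D) z`. The polar form is
  therefore `∫ ⟨R^*(D) λ, d⟩ = ∫ ⟨λ, R(D) d⟩ = 0`. The boundary terms of both integrations by
  parts contain only derivatives of `d` that the contact order forces to be zero.
-/

namespace Gluskabi

/-! ### Calculus of the operators `p(D)` on smooth signals -/

/-- The real vector space `C^∞(ℝ, ℝ)`. -/
def smoothFun : Submodule ℝ (ℝ → ℝ) where
  carrier := {f | ContDiff ℝ ∞ f}
  add_mem' {f g} hf hg := by
    rw [mem_ofPred_eq] at *
    exact hf.add hg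
  zero_mem' := by
    rw [mem_ofPred_eq]
    exact contDiff_const
  smul_mem' c f hf := by
    rw [mem_ofPred_eq] at *
    exact contDiff_const.smul hf

theorem contDiff_deriv_infty {f : ℝ → ℝ} (hf : ContDiff ℝ ∞ f) : ContDiff ℝ ∞ (deriv f) :=
  (contDiff_infty_iff_deriv.1 hf).2

theorem contDiff_iteratedDeriv {f : ℝ → ℝ} (hf : ContDiff ℝ ∞ f) (k : ℕ) :
    ContDiff ℝ ∞ (iteratedDeriv k f) := by
  rw [iteratedDeriv_eq_iterate]
  exact hf.iterate_deriv k

/-- Differentiation as an endomorphism of `C^∞(ℝ, ℝ)`. It makes `p ↦ p(D)` the evaluation of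
polynomials at `D`, so that the algebra of `polyD` is that of `Polynomial.aeval`. -/
noncomputable def smoothD : smoothFun →ₗ[ℝ] smoothFun where
  toFun f := ⟨deriv f.1, contDiff_deriv_infty f.2⟩
  map_add' f g := by
    ext t
    exact deriv_add ((contDiff_infty_iff_deriv.1 f.2).1 t) ((contDiff_infty_iff_deriv.1 g.2).1 t)
  map_smul' c f := by
    ext t
    exact deriv_const_smul c ((contDiff_infty_iff_deriv.1 f.2).1 t)

theorem smoothD_pow_coe (k : ℕ) (f : smoothFun) :
    ((smoothD ^ k) f : ℝ → ℝ) = iteratedDeriv k (f : ℝ → ℝ) := by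
  induction k generalizing f with
  | zero => simp
  | succ k ih => rw [pow_succ, Module.End.mul_apply, ih, iteratedDeriv_succ']; rfl

theorem aeval_smoothD_coe (p : ℝ[X]) (f : smoothFun) :
    (aeval smoothD p f : ℝ → ℝ) = polyD p f := by
  ext t
  rw [aeval_def, eval₂_eq_sum, Polynomial.sum, LinearMap.sum_apply, Submodule.coe_sum,
    Finset.sum_apply]
  simp only [← Algebra.smul_def, LinearMap.smul_apply, Submodule.coe_smul, smoothD_pow_coe,
    Pi.smul_apply, smul_eq_mul]
  rfl

theorem contDiff_polyD (p : ℝ[X]) {f : ℝ → ℝ} (hf : ContDiff ℝ ∞ f) :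
    ContDiff ℝ ∞ (polyD p f) := by
  rw [← aeval_smoothD_coe p ⟨f, hf⟩]
  exact (aeval smoothD p ⟨f, hf⟩).2

theorem polyD_mul (p q : ℝ[X]) {f : ℝ → ℝ} (hf : ContDiff ℝ ∞ f) :
    polyD (p * q) f = polyD p (polyD q f) := by
  have h := aeval_smoothD_coe (p * q) ⟨f, hf⟩
  rw [map_mul, Module.End.mul_apply, aeval_smoothD_coe, aeval_smoothD_coe] at h
  exact h.symm

theorem polyD_add (p q : ℝ[X]) {f : ℝ → ℝ} (hf : ContDiff ℝ ∞ f) :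
    polyD (p + q) f = polyD p f + polyD q f := by
  have h := aeval_smoothD_coe (p + q) ⟨f, hf⟩
  rw [map_add, LinearMap.add_apply, Submodule.coe_add, aeval_smoothD_coe, aeval_smoothD_coe] at h
  exact h.symm

theorem polyD_sum {ι : Type} (s : Finset ι) (p : ι → ℝ[X]) {f : ℝ → ℝ} (hf : ContDiff ℝ ∞ f) :
    polyD (∑ i ∈ s, p i) f = ∑ i ∈ s, polyD (p i) f := by
  have h := aeval_smoothD_coe (∑ i ∈ s, p i) ⟨f, hf⟩
  rw [map_sum, LinearMap.sum_apply, Submodule.coe_sum] at h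
  simp only [aeval_smoothD_coe] at h
  exact h.symm

theorem polyD_add_fun (p : ℝ[X]) {f g : ℝ → ℝ} (hf : ContDiff ℝ ∞ f) (hg : ContDiff ℝ ∞ g) :
    polyD p (f + g) = polyD p f + polyD p g := by
  have h := aeval_smoothD_coe p (⟨f, hf⟩ + ⟨g, hg⟩)
  rw [map_add, Submodule.coe_add, aeval_smoothD_coe, aeval_smoothD_coe] at h
  exact h.symm

theorem polyD_smul_fun (p : ℝ[X]) (c : ℝ) {f : ℝ → ℝ} (hf : ContDiff ℝ ∞ f) :
    polyD p (c • f) = c • polyD p f := by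
  have h := aeval_smoothD_coe p (c • ⟨f, hf⟩)
  rw [map_smul, Submodule.coe_smul, aeval_smoothD_coe] at h
  exact h.symm

theorem polyD_sum_fun {ι : Type} (s : Finset ι) (p : ℝ[X]) {f : ι → ℝ → ℝ}
    (hf : ∀ i, ContDiff ℝ ∞ (f i)) :
    polyD p (∑ i ∈ s, f i) = ∑ i ∈ s, polyD p (f i) := by
  have h := aeval_smoothD_coe p (∑ i ∈ s, ⟨f i, hf i⟩)
  rw [map_sum, Submodule.coe_sum, Submodule.coe_sum] at h
  simp only [aeval_smoothD_coe] at h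
  exact h.symm

theorem polyD_neg (p : ℝ[X]) (f : ℝ → ℝ) : polyD (-p) f = -polyD p f := by
  ext t
  simp [polyD, Polynomial.sum]

theorem polyD_zero (f : ℝ → ℝ) : polyD 0 f = 0 := by
  ext t
  simp [polyD]

theorem polyD_X_pow (k : ℕ) (f : ℝ → ℝ) : polyD (X ^ k) f = iteratedDeriv k f := by
  ext t
  rw [← monomial_one_right_eq_X_pow]
  simp [polyD, Polynomial.sum_monomial_index]

theorem polyD_one (f : ℝ → ℝ) : polyD 1 f = f := by
  rw [← pow_zero X, polyD_X_pow, iteratedDeriv_zero]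

theorem polyD_zero_fun (p : ℝ[X]) : polyD p (fun _ => 0) = 0 := by
  have h := polyD_smul_fun p 0 (f := fun _ => 0) contDiff_const
  rw [zero_smul, zero_smul] at h
  exact h

/-- Differential operators are local. -/
theorem polyD_congr (p : ℝ[X]) {f g : ℝ → ℝ} {t : ℝ} (h : f =ᶠ[nhds t] g) :
    polyD p f t = polyD p g t := by
  simp only [polyD, fun k => h.iteratedDeriv_eq k]

/-! ### Matrix differential operators -/

section matD

variable {κ ι ν : Type} [Fintype ι] [Fintype ν]

theorem contDiff_comp {w : ℝ → ι → ℝ} (hw : ContDiff ℝ ∞ w) (j : ι) :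
    ContDiff ℝ ∞ (fun t => w t j) := contDiff_pi.1 hw j

theorem matD_comp (R : Matrix κ ι ℝ[X]) (w : ℝ → ι → ℝ) (i : κ) :
    (fun t => matD R w t i) = ∑ j, polyD (R i j) (fun s => w s j) := by
  ext t
  simp [matD]

theorem contDiff_matD [Fintype κ] (R : Matrix κ ι ℝ[X]) {w : ℝ → ι → ℝ} (hw : ContDiff ℝ ∞ w) :
    ContDiff ℝ ∞ (matD R w) :=
  contDiff_pi.2 fun _ => ContDiff.sum fun j _ => contDiff_polyD _ (contDiff_comp hw j)

theorem matD_mul (A : Matrix κ ι ℝ[X]) (B : Matrix ι ν ℝ[X]) {w : ℝ → ν → ℝ}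
    (hw : ContDiff ℝ ∞ w) : matD (A * B) w = matD A (matD B w) := by
  ext t i
  simp only [matD, Matrix.mul_apply]
  have h1 : ∀ j, polyD (∑ k, A i k * B k j) (fun s => w s j) t =
      ∑ k, polyD (A i k) (polyD (B k j) (fun s => w s j)) t := by
    intro j
    rw [polyD_sum _ _ (contDiff_comp hw j), Finset.sum_apply]
    simp only [polyD_mul _ _ (contDiff_comp hw j)]
  have h2 : ∀ k, polyD (A i k) (fun s => ∑ j, polyD (B k j) (fun s => w s j) s) t =
      ∑ j, polyD (A i k) (polyD (B k j) (fun s => w s j)) t := by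
    intro k
    have : (fun s => ∑ j, polyD (B k j) (fun s => w s j) s) =
        ∑ j, polyD (B k j) (fun s => w s j) := by
      ext s
      simp
    rw [this, polyD_sum_fun _ _ fun j => contDiff_polyD _ (contDiff_comp hw j), Finset.sum_apply]
  simp only [h1, h2]
  exact Finset.sum_comm

theorem matD_add (A B : Matrix κ ι ℝ[X]) {w : ℝ → ι → ℝ} (hw : ContDiff ℝ ∞ w) :
    matD (A + B) w = matD A w + matD B w := by
  ext t i
  simp [matD, polyD_add _ _ (contDiff_comp hw _), Finset.sum_add_distrib]

theorem matD_neg (A : Matrix κ ι ℝ[X]) (w : ℝ → ι → ℝ) : matD (-A) w = -matD A w := by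
  ext t i
  simp [matD, polyD_neg]

theorem matD_zero (w : ℝ → ι → ℝ) : matD (0 : Matrix κ ι ℝ[X]) w = 0 := by
  ext t i
  simp [matD, polyD_zero]

theorem matD_add_fun (A : Matrix κ ι ℝ[X]) {v w : ℝ → ι → ℝ} (hv : ContDiff ℝ ∞ v)
    (hw : ContDiff ℝ ∞ w) : matD A (v + w) = matD A v + matD A w := by
  ext t i
  have h : ∀ j, polyD (A i j) (fun s => (v + w) s j) =
      polyD (A i j) (fun s => v s j) + polyD (A i j) (fun s => w s j) :=
    fun j => polyD_add_fun _ (contDiff_comp hv j) (contDiff_comp hw j)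
  simp only [matD, h]
  simp [matD, Finset.sum_add_distrib]

theorem matD_smul_fun (A : Matrix κ ι ℝ[X]) (c : ℝ) {w : ℝ → ι → ℝ} (hw : ContDiff ℝ ∞ w) :
    matD A (c • w) = c • matD A w := by
  ext t i
  have h : ∀ j, polyD (A i j) (fun s => (c • w) s j) = c • polyD (A i j) (fun s => w s j) :=
    fun j => polyD_smul_fun _ _ (contDiff_comp hw j)
  simp only [matD, h]
  simp [matD, Finset.mul_sum]

theorem matD_zero_fun (A : Matrix κ ι ℝ[X]) : matD A (fun _ => 0) = 0 := by
  ext t i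
  simp only [matD, Pi.zero_apply, polyD_zero_fun]
  simp

theorem matD_diagonal [DecidableEq ι] (d : ι → ℝ[X]) (w : ℝ → ι → ℝ) (t : ℝ) (i : ι) :
    matD (Matrix.diagonal d) w t i = polyD (d i) (fun s => w s i) t := by
  rw [matD, Finset.sum_eq_single i]
  · simp
  · intro j _ hj
    rw [Matrix.diagonal_apply_ne' _ hj, polyD_zero]
    rfl
  · simp

theorem matD_one [DecidableEq ι] (w : ℝ → ι → ℝ) : matD (1 : Matrix ι ι ℝ[X]) w = w := by
  ext t i
  rw [← Matrix.diagonal_one, matD_diagonal, polyD_one]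

theorem matD_extOp [DecidableEq ι] (p : ℝ[X]) (w : ℝ → ι → ℝ) (t : ℝ) (i : ι) :
    matD (extOp ι p) w t i = polyD p (fun s => w s i) t := by
  rw [extOp, Matrix.smul_one_eq_diagonal, matD_diagonal]

theorem matD_congr (A : Matrix κ ι ℝ[X]) {v w : ℝ → ι → ℝ} {t : ℝ} (h : v =ᶠ[nhds t] w) :
    matD A v t = matD A w t := by
  ext i
  refine Finset.sum_congr rfl fun j _ => polyD_congr _ ?_
  filter_upwards [h] with s hs
  rw [hs]

end matD

/-! ### Integration by parts -/

/-- The derivatives of `h` of order less than `n` vanish at `a` and at `b`. -/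
def VanishTo (a b : ℝ) (n : ℕ) (h : ℝ → ℝ) : Prop :=
  ∀ k < n, iteratedDeriv k h a = 0 ∧ iteratedDeriv k h b = 0

theorem integral_mul_iteratedDeriv {a b : ℝ} {f h : ℝ → ℝ} (hf : ContDiff ℝ ∞ f)
    (hh : ContDiff ℝ ∞ h) {n : ℕ} (hb : VanishTo a b n h) :
    ∫ t in a..b, f t * iteratedDeriv n h t = (-1) ^ n * ∫ t in a..b, iteratedDeriv n f t * h t := by
  induction n generalizing f with
  | zero => simp
  | succ n ih =>
    have hh' := contDiff_iteratedDeriv hh n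
    have hf' := contDiff_deriv_infty hf
    rw [iteratedDeriv_succ, intervalIntegral.integral_mul_deriv_eq_deriv_mul
      (fun x _ => ((contDiff_infty_iff_deriv.1 hf).1 x).hasDerivAt)
      (fun x _ => ((contDiff_infty_iff_deriv.1 hh').1 x).hasDerivAt)
      (hf'.continuous.intervalIntegrable _ _)
      ((contDiff_deriv_infty hh').continuous.intervalIntegrable _ _),
      (hb n n.lt_succ_self).1, (hb n n.lt_succ_self).2,
      ih hf' fun k hk => hb k (hk.trans n.lt_succ_self), iteratedDeriv_succ', pow_succ]
    ring

theorem polyD_comp_neg_X (q : ℝ[X]) {f : ℝ → ℝ} (hf : ContDiff ℝ ∞ f) (t : ℝ) :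
    polyD (q.comp (-X)) f t =
      ∑ k ∈ q.support, q.coeff k * ((-1) ^ k * iteratedDeriv k f t) := by
  have h : q.comp (-X) = ∑ k ∈ q.support, C (q.coeff k * (-1) ^ k) * X ^ k := by
    rw [comp_eq_sum_left, Polynomial.sum]
    refine Finset.sum_congr rfl fun k _ => ?_
    rw [neg_pow, C_mul, C_pow, C_neg, C_1, mul_assoc]
  rw [h, polyD_sum _ _ hf, Finset.sum_apply]
  refine Finset.sum_congr rfl fun k _ => ?_
  rw [C_mul_X_pow_eq_monomial]
  simp [polyD, Polynomial.sum_monomial_index, mul_assoc]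

/-- `q(-D)` is the formal adjoint of `q(D)`; the boundary terms contain only the derivatives of
order less than `deg q`. -/
theorem integral_mul_polyD {a b : ℝ} (q : ℝ[X]) {f h : ℝ → ℝ} (hf : ContDiff ℝ ∞ f)
    (hh : ContDiff ℝ ∞ h) (hb : VanishTo a b q.natDegree h) :
    ∫ t in a..b, f t * polyD q h t = ∫ t in a..b, polyD (q.comp (-X)) f t * h t := by
  have h1 : ∀ t, f t * polyD q h t =
      ∑ k ∈ q.support, q.coeff k * (f t * iteratedDeriv k h t) := by
    intro t
    simp only [polyD, Polynomial.sum, Finset.mul_sum]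
    exact Finset.sum_congr rfl fun k _ => by ring
  have h2 : ∀ t, polyD (q.comp (-X)) f t * h t =
      ∑ k ∈ q.support, q.coeff k * ((-1) ^ k * (iteratedDeriv k f t * h t)) := by
    intro t
    rw [polyD_comp_neg_X q hf, Finset.sum_mul]
    exact Finset.sum_congr rfl fun k _ => by ring
  simp only [h1, h2]
  rw [intervalIntegral.integral_finsetSum, intervalIntegral.integral_finsetSum]
  · refine Finset.sum_congr rfl fun k hk => ?_
    rw [intervalIntegral.integral_const_mul, intervalIntegral.integral_const_mul,
      intervalIntegral.integral_const_mul, integral_mul_iteratedDeriv hf hh fun j hj =>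
        hb j (hj.trans_le (le_natDegree_of_mem_supp k hk))]
  · intro k _
    exact (continuous_const.mul (continuous_const.mul
      ((contDiff_iteratedDeriv hf k).continuous.mul hh.continuous))).intervalIntegrable _ _
  · intro k _
    exact (continuous_const.mul
      (hf.continuous.mul (contDiff_iteratedDeriv hh k).continuous)).intervalIntegrable _ _

/-- `R^*(D)` is the formal adjoint of `R(D)` for the pairing of vector signals in `L²(a, b)`. -/
theorem integral_dotProduct_matD {κ ι : Type} [Fintype κ] [Fintype ι] {a b : ℝ}
    (R : Matrix κ ι ℝ[X]) {f : ℝ → κ → ℝ} {h : ℝ → ι → ℝ} (hf : ContDiff ℝ ∞ f)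
    (hh : ContDiff ℝ ∞ h)
    (hb : ∀ i j, VanishTo a b (R i j).natDegree (fun t => h t j)) :
    ∫ t in a..b, f t ⬝ᵥ matD R h t = ∫ t in a..b, matD (adj R) f t ⬝ᵥ h t := by
  have hf' := fun i => contDiff_comp hf i
  have hh' := fun j => contDiff_comp hh j
  simp only [dotProduct, matD, adj, Finset.mul_sum, Finset.sum_mul, Matrix.transpose_apply,
    Matrix.map_apply]
  rw [intervalIntegral.integral_finsetSum, intervalIntegral.integral_finsetSum]
  · simp_rw [fun j => intervalIntegral.integral_finsetSum (μ := MeasureTheory.volume) (a := a)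
      (b := b) (s := Finset.univ)
      (f := fun i t => polyD ((R i j).comp (-X)) (fun s => f s i) t * h t j)
      (fun i _ => ((contDiff_polyD _ (hf' i)).continuous.mul
        (hh' j).continuous).intervalIntegrable _ _)]
    rw [Finset.sum_comm]
    refine Finset.sum_congr rfl fun i _ => ?_
    rw [intervalIntegral.integral_finsetSum]
    · exact Finset.sum_congr rfl fun j _ => integral_mul_polyD _ (hf' i) (hh' j) (hb i j)
    · exact fun j _ => ((hf' i).continuous.mul
        (contDiff_polyD _ (hh' j)).continuous).intervalIntegrable _ _
  · exact fun j _ => (continuous_finsetSum _ fun i _ => (contDiff_polyD _ (hf' i)).continuous.mul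
      (hh' j).continuous).intervalIntegrable _ _
  · exact fun i _ => (continuous_finsetSum _ fun j _ => (hf' i).continuous.mul
      (contDiff_polyD _ (hh' j)).continuous).intervalIntegrable _ _

/-! ### The polarized Sobolev cost -/

section energy

/-- The polar form of `f ↦ ∑ᵢ ρᵢ ∫ |D^i p(D) f|²`, where `W = ∑ᵢ ρᵢ ξ^i`. -/
noncomputable def sobolevForm (p W : ℝ[X]) (a b : ℝ) (f h : ℝ → ℝ) : ℝ :=
  W.sum fun i ρ => ρ * ∫ t in a..b, polyD (X ^ i * p) f t * polyD (X ^ i * p) h t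

theorem sobolevForm_add_smul (p W : ℝ[X]) (a b c : ℝ) {f h : ℝ → ℝ} (hf : ContDiff ℝ ∞ f)
    (hh : ContDiff ℝ ∞ h) :
    sobolevForm p W a b (f + c • h) (f + c • h) =
      sobolevForm p W a b f f + 2 * c * sobolevForm p W a b f h +
        c ^ 2 * sobolevForm p W a b h h := by
  simp only [sobolevForm, Polynomial.sum, Finset.mul_sum]
  rw [← Finset.sum_add_distrib, ← Finset.sum_add_distrib]
  refine Finset.sum_congr rfl fun i _ => ?_
  have hch : ContDiff ℝ ∞ (c • h) := contDiff_const.smul hh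
  have cf := (contDiff_polyD (X ^ i * p) hf).continuous
  have ch := (contDiff_polyD (X ^ i * p) hh).continuous
  set F := polyD (X ^ i * p) f
  set H := polyD (X ^ i * p) h
  have h1 : ∀ t, polyD (X ^ i * p) (f + c • h) t * polyD (X ^ i * p) (f + c • h) t =
      F t * F t + 2 * c * (F t * H t) + c ^ 2 * (H t * H t) := by
    intro t
    rw [polyD_add_fun _ hf hch, polyD_smul_fun _ _ hh]
    simp only [Pi.add_apply, Pi.smul_apply, smul_eq_mul, F, H]
    ring
  simp only [h1]
  rw [intervalIntegral.integral_add, intervalIntegral.integral_add,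
    intervalIntegral.integral_const_mul, intervalIntegral.integral_const_mul]
  · ring
  all_goals exact Continuous.intervalIntegrable (by fun_prop) _ _

theorem sobolevForm_self_nonneg (p : ℝ[X]) {W : ℝ[X]} (hW : ∀ i, 0 ≤ W.coeff i) {a b : ℝ}
    (hab : a ≤ b) (f : ℝ → ℝ) : 0 ≤ sobolevForm p W a b f f :=
  Finset.sum_nonneg fun i _ => mul_nonneg (hW i)
    (intervalIntegral.integral_nonneg hab fun _ _ => mul_self_nonneg _)

/-- `p(-D) W(-D²) p(D)`, the operator of the Euler-Lagrange equation of `sobolevForm p W`. -/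
noncomputable def eulerPoly (p W : ℝ[X]) : ℝ[X] :=
  p.comp (-X) * sobolevOp W * p

theorem eulerPoly_eq_sum (p W : ℝ[X]) :
    eulerPoly p W =
      ∑ i ∈ W.support, C (W.coeff i) * ((X ^ i * p).comp (-X) * (X ^ i * p)) := by
  rw [eulerPoly, sobolevOp, comp_eq_sum_left (p := W), Polynomial.sum, Finset.mul_sum,
    Finset.sum_mul]
  refine Finset.sum_congr rfl fun i _ => ?_
  rw [mul_comp, pow_comp, X_comp, neg_pow (X ^ 2 : ℝ[X]), neg_pow (X : ℝ[X]), ← pow_mul]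
  ring

theorem polyD_C_mul (c : ℝ) (q : ℝ[X]) {f : ℝ → ℝ} (hf : ContDiff ℝ ∞ f) :
    polyD (C c * q) f = c • polyD q f := by
  rw [polyD_mul _ _ hf]
  ext t
  rw [polyD, Polynomial.sum_C_index (by simp)]
  simp

/-- The boundary terms of the integrations by parts contain the derivatives of the variation of
order less than `deg p + deg W`. -/
theorem sobolevForm_eq_integral (p W : ℝ[X]) {a b : ℝ} {f h : ℝ → ℝ} (hf : ContDiff ℝ ∞ f)
    (hh : ContDiff ℝ ∞ h) (hb : VanishTo a b (p.natDegree + W.natDegree) h) :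
    sobolevForm p W a b f h = ∫ t in a..b, polyD (eulerPoly p W) f t * h t := by
  have h1 : ∀ t, polyD (eulerPoly p W) f t * h t = ∑ i ∈ W.support,
      W.coeff i * (polyD ((X ^ i * p).comp (-X)) (polyD (X ^ i * p) f) t * h t) := by
    intro t
    rw [eulerPoly_eq_sum, polyD_sum _ _ hf, Finset.sum_apply, Finset.sum_mul]
    refine Finset.sum_congr rfl fun i _ => ?_
    rw [polyD_C_mul _ _ hf, polyD_mul _ _ hf, Pi.smul_apply, smul_eq_mul]
    ring
  simp only [h1]
  rw [intervalIntegral.integral_finsetSum]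
  · refine Finset.sum_congr rfl fun i hi => ?_
    beta_reduce
    rw [intervalIntegral.integral_const_mul,
      integral_mul_polyD _ (contDiff_polyD _ hf) hh fun k hk => hb k ?_]
    have h2 : (X ^ i * p).natDegree ≤ i + p.natDegree :=
      natDegree_mul_le.trans (by simp)
    have h3 := le_natDegree_of_mem_supp i hi
    omega
  · exact fun i _ => (continuous_const.mul
      ((contDiff_polyD _ (contDiff_polyD _ hf)).continuous.mul
        hh.continuous)).intervalIntegrable _ _

variable {ι : Type} [Fintype ι]

/-- The sum of the polar forms `sobolevForm` over the components, with a weight polynomial for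
each component. -/
noncomputable def energy (p : ℝ[X]) (W : ι → ℝ[X]) (a b : ℝ) (v w : ℝ → ι → ℝ) : ℝ :=
  ∑ j, sobolevForm p (W j) a b (fun t => v t j) (fun t => w t j)

theorem energy_add_smul (p : ℝ[X]) (W : ι → ℝ[X]) (a b c : ℝ) {v d : ℝ → ι → ℝ}
    (hv : ContDiff ℝ ∞ v) (hd : ContDiff ℝ ∞ d) :
    energy p W a b (v + c • d) (v + c • d) =
      energy p W a b v v + 2 * c * energy p W a b v d + c ^ 2 * energy p W a b d d := by
  simp only [energy, Finset.mul_sum, ← Finset.sum_add_distrib]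
  exact Finset.sum_congr rfl fun j _ =>
    sobolevForm_add_smul p (W j) a b c (contDiff_comp hv j) (contDiff_comp hd j)

theorem energy_self_nonneg (p : ℝ[X]) {W : ι → ℝ[X]} (hW : ∀ j i, 0 ≤ (W j).coeff i) {a b : ℝ}
    (hab : a ≤ b) (v : ℝ → ι → ℝ) : 0 ≤ energy p W a b v v :=
  Finset.sum_nonneg fun j _ => sobolevForm_self_nonneg p (hW j) hab _

theorem energy_eq_integral [DecidableEq ι] (p : ℝ[X]) (W : ι → ℝ[X]) {a b : ℝ}
    {v d : ℝ → ι → ℝ} (hv : ContDiff ℝ ∞ v) (hd : ContDiff ℝ ∞ d)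
    (hb : ∀ j, VanishTo a b (p.natDegree + (W j).natDegree) (fun t => d t j)) :
    energy p W a b v d =
      ∫ t in a..b, matD (Matrix.diagonal fun j => eulerPoly p (W j)) v t ⬝ᵥ d t := by
  simp only [dotProduct, matD_diagonal]
  rw [intervalIntegral.integral_finsetSum]
  · exact Finset.sum_congr rfl fun j _ =>
      sobolevForm_eq_integral p (W j) (contDiff_comp hv j) (contDiff_comp hd j) (hb j)
  · exact fun j _ => ((contDiff_polyD _ (contDiff_comp hv j)).continuous.mul
      (contDiff_comp hd j).continuous).intervalIntegrable _ _

theorem sobolevSq_extOp [DecidableEq ι] (p W : ℝ[X]) (a b : ℝ) {w : ℝ → ι → ℝ}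
    (hw : ContDiff ℝ ∞ w) :
    sobolevSq W a b (matD (extOp ι p) w) = energy p (fun _ => W) a b w w := by
  simp only [energy, sobolevSq, sobolevForm, Polynomial.sum]
  rw [Finset.sum_comm]
  refine Finset.sum_congr rfl fun i _ => ?_
  rw [← Finset.mul_sum, ← intervalIntegral.integral_finsetSum]
  · have h : ∀ j, iteratedDeriv i (fun s => matD (extOp ι p) w s j) =
        polyD (X ^ i * p) (fun s => w s j) := by
      intro j
      rw [polyD_mul _ _ (contDiff_comp hw j), polyD_X_pow]
      congr 1
      ext t
      exact matD_extOp p w t j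
    simp only [h, sq]
  · exact fun j _ => ((contDiff_polyD _ (contDiff_comp hw j)).continuous.mul
      (contDiff_polyD _ (contDiff_comp hw j)).continuous).intervalIntegrable _ _

theorem cost_eq_energy {m g : ℕ} (p Wu Wy : ℝ[X]) (a b : ℝ) {w : ℝ → Fin m ⊕ Fin g → ℝ}
    (hw : ContDiff ℝ ∞ w) :
    cost p Wu Wy a b w =
      energy p (Sum.elim (fun _ => Wu) (fun _ => Wy)) a b w w := by
  rw [cost, sobolevSq_extOp, sobolevSq_extOp]
  · simp [energy, input, output]
  · exact contDiff_pi.2 fun j => contDiff_comp hw (Sum.inr j)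
  · exact contDiff_pi.2 fun j => contDiff_comp hw (Sum.inl j)

end energy

/-! ### Flat variations -/

theorem iteratedDeriv_eq_zero_of_eqOn_Iio {f : ℝ → ℝ} (hf : ContDiff ℝ ∞ f) {a : ℝ}
    (h : ∀ t < a, f t = 0) (k : ℕ) : iteratedDeriv k f a = 0 := by
  have h1 : EqOn (iteratedDeriv k f) 0 (Iio a) := by
    intro t ht
    have h2 : f =ᶠ[nhds t] fun _ => 0 := by
      filter_upwards [isOpen_Iio.mem_nhds ht] with s hs using h s hs
    rw [h2.iteratedDeriv_eq k, iteratedDeriv_fun_const_zero]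
    rfl
  exact h1.closure (contDiff_iteratedDeriv hf k).continuous continuous_const
    (by rw [closure_Iio]; exact self_mem_Iic)

theorem iteratedDeriv_eq_zero_of_eqOn_Ioi {f : ℝ → ℝ} (hf : ContDiff ℝ ∞ f) {a : ℝ}
    (h : ∀ t, a < t → f t = 0) (k : ℕ) : iteratedDeriv k f a = 0 := by
  have h1 : EqOn (iteratedDeriv k f) 0 (Ioi a) := by
    intro t ht
    have h2 : f =ᶠ[nhds t] fun _ => 0 := by
      filter_upwards [isOpen_Ioi.mem_nhds ht] with s hs using h s hs
    rw [h2.iteratedDeriv_eq k, iteratedDeriv_fun_const_zero]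
    rfl
  exact h1.closure (contDiff_iteratedDeriv hf k).continuous continuous_const
    (by rw [closure_Ioi]; exact self_mem_Ici)

theorem iteratedDeriv_polyD (k : ℕ) (q : ℝ[X]) {f : ℝ → ℝ} (hf : ContDiff ℝ ∞ f) :
    iteratedDeriv k (polyD q f) = polyD (X ^ k * q) f := by
  rw [polyD_mul _ _ hf, polyD_X_pow]

theorem iteratedDeriv_polyD_eq_zero {q : ℝ[X]} {f : ℝ → ℝ} (hf : ContDiff ℝ ∞ f) {c : ℝ}
    (h : ∀ k, iteratedDeriv k f c = 0) (k : ℕ) : iteratedDeriv k (polyD q f) c = 0 := by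
  rw [iteratedDeriv_polyD k q hf, polyD]
  simp [h, Polynomial.sum]

theorem iteratedDeriv_matD_eq_zero {κ ι : Type} [Fintype ι] (R : Matrix κ ι ℝ[X])
    {w : ℝ → ι → ℝ} (hw : ContDiff ℝ ∞ w) {c : ℝ}
    (h : ∀ j k, iteratedDeriv k (fun t => w t j) c = 0) (i : κ) (k : ℕ) :
    iteratedDeriv k (fun t => matD R w t i) c = 0 := by
  have h1 := fun j => contDiff_comp hw j
  rw [matD_comp, ← polyD_X_pow, polyD_sum_fun _ _ fun j => contDiff_polyD _ (h1 j),
    Finset.sum_apply]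
  refine Finset.sum_eq_zero fun j _ => ?_
  rw [polyD_X_pow]
  exact iteratedDeriv_polyD_eq_zero (h1 j) (h j) k

/-- A smooth function that is positive on `(a, b)` and zero elsewhere. -/
noncomputable def glueBump (a b t : ℝ) : ℝ :=
  expNegInvGlue (t - a) * expNegInvGlue (b - t)

theorem contDiff_glueBump (a b : ℝ) : ContDiff ℝ ∞ (glueBump a b) :=
  (expNegInvGlue.contDiff.comp (contDiff_id.sub contDiff_const)).mul
    (expNegInvGlue.contDiff.comp (contDiff_const.sub contDiff_id))

theorem glueBump_pos {a b t : ℝ} (h : t ∈ Ioo a b) : 0 < glueBump a b t :=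
  mul_pos (expNegInvGlue.pos_of_pos (sub_pos.2 h.1)) (expNegInvGlue.pos_of_pos (sub_pos.2 h.2))

theorem glueBump_nonneg (a b t : ℝ) : 0 ≤ glueBump a b t :=
  mul_nonneg (expNegInvGlue.nonneg _) (expNegInvGlue.nonneg _)

theorem glueBump_of_le {a b t : ℝ} (h : t ≤ a) : glueBump a b t = 0 := by
  rw [glueBump, expNegInvGlue.zero_of_nonpos (sub_nonpos.2 h), zero_mul]

theorem glueBump_of_ge {a b t : ℝ} (h : b ≤ t) : glueBump a b t = 0 := by
  rw [glueBump, expNegInvGlue.zero_of_nonpos (sub_nonpos.2 h), mul_zero]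

/-- The fundamental lemma of the calculus of variations, for variations all of whose derivatives
vanish at the end points. -/
theorem eq_zero_of_integral_flat {ι : Type} [Fintype ι] {a b : ℝ} (hab : a < b) {z : ℝ → ι → ℝ}
    (hz : ContDiff ℝ ∞ z)
    (h : ∀ d : ℝ → ι → ℝ, ContDiff ℝ ∞ d →
      (∀ j k, iteratedDeriv k (fun t => d t j) a = 0 ∧ iteratedDeriv k (fun t => d t j) b = 0) →
      ∫ t in a..b, z t ⬝ᵥ d t = 0) :
    ∀ t ∈ Icc a b, z t = 0 := by
  have hχ := contDiff_glueBump a b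
  have hcz : Continuous z := hz.continuous
  have hd : ContDiff ℝ ∞ (fun t => glueBump a b t • z t) := hχ.smul hz
  have h0 := h _ hd fun j k =>
    ⟨iteratedDeriv_eq_zero_of_eqOn_Iio (contDiff_comp hd j)
      (fun t ht => by simp [glueBump_of_le ht.le]) k,
     iteratedDeriv_eq_zero_of_eqOn_Ioi (contDiff_comp hd j)
      (fun t ht => by simp [glueBump_of_ge ht.le]) k⟩
  have hsq : ∀ t, 0 ≤ z t ⬝ᵥ z t := fun t => Finset.sum_nonneg fun j _ => mul_self_nonneg _
  have hIoo : EqOn z 0 (Ioo a b) := by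
    intro t ht
    by_contra hne
    have hpos : 0 < z t ⬝ᵥ z t :=
      lt_of_le_of_ne (hsq t) fun h => hne (dotProduct_self_eq_zero.1 h.symm)
    refine (intervalIntegral.integral_pos hab ?_ ?_
      ⟨t, Ioo_subset_Icc_self ht, ?_⟩).ne' h0
    · exact (Continuous.dotProduct hcz hd.continuous).continuousOn
    · intro s _
      rw [dotProduct_smul]
      exact mul_nonneg (glueBump_nonneg a b s) (hsq s)
    · rw [dotProduct_smul]
      exact mul_pos (glueBump_pos ht) hpos
  have := hIoo.closure hcz continuous_const
  rwa [closure_Ioo hab.ne] at this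

/-! ### Formal adjoints of polynomial matrices -/

section adj

variable {κ ι ν : Type}

theorem adj_mul [Fintype ι] (A : Matrix κ ι ℝ[X]) (B : Matrix ι ν ℝ[X]) :
    adj (A * B) = adj B * adj A := by
  ext1 i j
  simp only [adj, Matrix.transpose_apply, Matrix.map_apply, Matrix.mul_apply]
  rw [← coe_compRingHom_apply, map_sum]
  exact Finset.sum_congr rfl fun k _ => by
    rw [map_mul, coe_compRingHom_apply, coe_compRingHom_apply, mul_comm]

theorem adj_add (A B : Matrix κ ι ℝ[X]) : adj (A + B) = adj A + adj B := by
  ext1 i j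
  simp [adj]

theorem adj_one [DecidableEq ι] : adj (1 : Matrix ι ι ℝ[X]) = 1 := by
  ext1 i j
  by_cases h : i = j
  · subst h
    simp [adj]
  · simp [adj, Matrix.one_apply_ne h, Matrix.one_apply_ne' h]

end adj

/-! ### Image representations -/

/-- A kernel matrix `R`, an image matrix `M` and polynomial matrices `Y`, `L` with `R M = 0` and
`Y R + M L = 1`. It makes the solutions of `R(D) w = 0` exactly the signals `M(D) η`, and, by
taking adjoints, every `z` with `M^*(D) z = 0` a signal `R^*(D) λ`. -/
structure IsExactPair {κ ι ν : Type} [Fintype κ] [Fintype ι] [Fintype ν] [DecidableEq ι]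
    (R : Matrix κ ι ℝ[X]) (M : Matrix ι ν ℝ[X]) (Y : Matrix ι κ ℝ[X]) (L : Matrix ν ι ℝ[X]) :
    Prop where
  mul_eq_zero : R * M = 0
  add_eq_one : Y * R + M * L = 1

theorem mem_behavior {κ ι : Type} [Fintype ι] {R : Matrix κ ι ℝ[X]} {w : ℝ → ι → ℝ} :
    w ∈ behavior R ↔ ContDiff ℝ ∞ w ∧ ∀ t, matD R w t = 0 := by
  rw [behavior, mem_ofPred_eq]

theorem behavior_add_smul {κ ι : Type} [Fintype ι] {R : Matrix κ ι ℝ[X]} {v d : ℝ → ι → ℝ}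
    (hv : v ∈ behavior R) (hd : d ∈ behavior R) (x : ℝ) :
    v + x • d ∈ behavior R := by
  obtain ⟨hvs, hv0⟩ := mem_behavior.1 hv
  obtain ⟨hds, hd0⟩ := mem_behavior.1 hd
  have hxd : ContDiff ℝ ∞ (x • d) := contDiff_const.smul hds
  refine mem_behavior.2 ⟨hvs.add hxd, fun t => ?_⟩
  rw [matD_add_fun _ hvs hxd, matD_smul_fun _ _ hds]
  simp [hv0, hd0]

section exact

variable {κ ι ν : Type} [Fintype κ] [Fintype ι] [Fintype ν] [DecidableEq ι]
  {R : Matrix κ ι ℝ[X]} {M : Matrix ι ν ℝ[X]} {Y : Matrix ι κ ℝ[X]} {L : Matrix ν ι ℝ[X]}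

theorem IsExactPair.matD_mem_behavior (hE : IsExactPair R M Y L) {η : ℝ → ν → ℝ}
    (hη : ContDiff ℝ ∞ η) : matD M η ∈ behavior R := by
  refine mem_behavior.2 ⟨contDiff_matD M hη, fun t => ?_⟩
  rw [← matD_mul _ _ hη, hE.mul_eq_zero, matD_zero]
  rfl

theorem IsExactPair.eq_matD_of_mem (hE : IsExactPair R M Y L) {w : ℝ → ι → ℝ}
    (hw : w ∈ behavior R) : w = matD M (matD L w) := by
  obtain ⟨hs, h0⟩ := mem_behavior.1 hw
  have h1 : matD R w = fun _ => 0 := funext h0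
  conv_lhs => rw [← matD_one w, ← hE.add_eq_one, matD_add _ _ hs, matD_mul _ _ hs,
    matD_mul _ _ hs, h1, matD_zero_fun, zero_add]

/-! ### Stationarity and optimality -/

/-- First-order condition: if the cost is stationary at `M(D) η` along all variations `M(D) δ`
with `δ` flat at the end points, the Euler-Lagrange equation holds. -/
theorem euler_eq_of_stationary (p : ℝ[X]) (W : ι → ℝ[X]) (M : Matrix ι ν ℝ[X]) {a b : ℝ}
    (hab : a < b) {η : ℝ → ν → ℝ} (hη : ContDiff ℝ ∞ η)
    (hst : ∀ d : ℝ → ν → ℝ, ContDiff ℝ ∞ d →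
      (∀ j k, iteratedDeriv k (fun t => d t j) a = 0 ∧ iteratedDeriv k (fun t => d t j) b = 0) →
      energy p W a b (matD M η) (matD M d) = 0) :
    ∀ t ∈ Icc a b,
      matD (adj M * Matrix.diagonal (fun j => eulerPoly p (W j)) * M) η t = 0 := by
  refine eq_zero_of_integral_flat hab (contDiff_matD _ hη) fun d hd hflat => ?_
  have hMη := contDiff_matD M hη
  rw [← hst d hd hflat, energy_eq_integral p W hMη (contDiff_matD M hd),
    integral_dotProduct_matD M (contDiff_matD _ hMη) hd]
  · rw [Matrix.mul_assoc, matD_mul _ _ hη, matD_mul _ _ hη]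
  · exact fun i j k _ => hflat j k
  · exact fun j k _ =>
      ⟨iteratedDeriv_matD_eq_zero M hd (fun j k => (hflat j k).1) j k,
       iteratedDeriv_matD_eq_zero M hd (fun j k => (hflat j k).2) j k⟩

/-- If `M(D) η` satisfies the Euler-Lagrange equation on `[a, b]`, the cost is stationary along
all admissible directions in the behavior that vanish to sufficient order at the end points. The
direction need not be the image of a signal that vanishes there; instead `z`, the gradient of the
cost, is written as `R^*(D) λ` and paired with the solution `d` of `R(D) d = 0`. -/
theorem IsExactPair.energy_eq_zero (hE : IsExactPair R M Y L) (p : ℝ[X]) (W : ι → ℝ[X])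
    {a b : ℝ} (hab : a < b) {η : ℝ → ν → ℝ} (hη : ContDiff ℝ ∞ η)
    (heq : ∀ t ∈ Icc a b,
      matD (adj M * Matrix.diagonal (fun j => eulerPoly p (W j)) * M) η t = 0)
    {d : ℝ → ι → ℝ} (hd : d ∈ behavior R)
    (hbW : ∀ j, VanishTo a b (p.natDegree + (W j).natDegree) (fun t => d t j))
    (hbR : ∀ i j, VanishTo a b (R i j).natDegree (fun t => d t j)) :
    energy p W a b (matD M η) d = 0 := by
  obtain ⟨hds, hd0⟩ := mem_behavior.1 hd
  have hMη := contDiff_matD M hη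
  rw [energy_eq_integral p W hMη hds hbW]
  rw [Matrix.mul_assoc, matD_mul _ _ hη, matD_mul _ _ hη] at heq
  set z := matD (Matrix.diagonal fun j => eulerPoly p (W j)) (matD M η)
  have hz : ContDiff ℝ ∞ z := contDiff_matD _ hMη
  have hdec : ∀ t, z t = matD (adj R) (matD (adj Y) z) t + matD (adj L) (matD (adj M) z) t := by
    intro t
    have h1 : adj R * adj Y + adj L * adj M = 1 := by
      rw [← adj_mul, ← adj_mul, ← adj_add, hE.add_eq_one, adj_one]
    conv_lhs => rw [← matD_one z, ← h1, matD_add _ _ hz, matD_mul _ _ hz, matD_mul _ _ hz]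
    rfl
  have hIoo : ∀ t ∈ Ioo a b, z t = matD (adj R) (matD (adj Y) z) t := by
    intro t ht
    have h1 : matD (adj M) z =ᶠ[nhds t] fun _ => 0 := by
      filter_upwards [isOpen_Ioo.mem_nhds ht] with s hs using heq s (Ioo_subset_Icc_self hs)
    have h2 := hdec t
    rwa [matD_congr _ h1, matD_zero_fun, Pi.zero_apply, add_zero] at h2
  have hcl := (show EqOn z (matD (adj R) (matD (adj Y) z)) (Ioo a b) from hIoo).closure
    hz.continuous (contDiff_matD (adj R) (contDiff_matD (adj Y) hz)).continuous
  rw [closure_Ioo hab.ne] at hcl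
  have h3 : ∫ t in a..b, z t ⬝ᵥ d t =
      ∫ t in a..b, matD (adj R) (matD (adj Y) z) t ⬝ᵥ d t := by
    refine intervalIntegral.integral_congr fun t ht => ?_
    rw [uIcc_of_le hab.le] at ht
    rw [hcl ht]
  rw [h3, ← integral_dotProduct_matD R (contDiff_matD (adj Y) hz) hds hbR]
  simp [hd0]

theorem Contact.iteratedDeriv_sub_eq_zero {ι : Type} [Fintype ι] {r : ι → ℕ∞} {c : ℝ}
    {v v' w : ℝ → ι → ℝ} (h : Contact r c v w) (h' : Contact r c v' w) (hv : ContDiff ℝ ∞ v)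
    (hv' : ContDiff ℝ ∞ v') {j : ι} {k : ℕ} (hk : (k : ℕ∞) ≤ r j) :
    iteratedDeriv k (fun t => (v' - v) t j) c = 0 := by
  have h1 : (fun t => (v' - v) t j) = (fun t => v' t j) + (-1 : ℝ) • fun t => v t j := by
    ext t
    simp [sub_eq_add_neg]
  have h2 : ContDiff ℝ ∞ ((-1 : ℝ) • fun t => v t j) := contDiff_const.smul (contDiff_comp hv j)
  rw [h1, ← polyD_X_pow, polyD_add_fun _ (contDiff_comp hv' j) h2,
    polyD_smul_fun _ _ (contDiff_comp hv j)]
  simp only [polyD_X_pow, Pi.add_apply, Pi.smul_apply]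
  simp [h j k hk, h' j k hk]

/-- Adding a signal with vanishing derivatives at `c` does not change the contact at `c`. -/
theorem Contact.add_smul_flat {ι : Type} [Fintype ι] {r : ι → ℕ∞} {c : ℝ} {v w d : ℝ → ι → ℝ}
    (h : Contact r c v w) (hv : ContDiff ℝ ∞ v) (hd : ContDiff ℝ ∞ d)
    (hflat : ∀ j k, iteratedDeriv k (fun t => d t j) c = 0) (x : ℝ) :
    Contact r c (v + x • d) w := by
  intro j k hk
  have h1 : (fun t => (v + x • d) t j) = (fun t => v t j) + x • fun t => d t j := by
    ext t
    simp
  have h2 : ContDiff ℝ ∞ (x • fun t => d t j) := contDiff_const.smul (contDiff_comp hd j)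
  rw [h1, ← polyD_X_pow, polyD_add_fun _ (contDiff_comp hv j) h2,
    polyD_smul_fun _ _ (contDiff_comp hd j)]
  simp only [polyD_X_pow, Pi.add_apply, Pi.smul_apply]
  simp [h j k hk, hflat j k]

theorem mem_connections {ι : Type} {B : Set (ℝ → ι → ℝ)} {r : ι → ℕ∞} {a b : ℝ}
    {w₁ w₂ v : ℝ → ι → ℝ} :
    v ∈ connections B r a b w₁ w₂ ↔ v ∈ B ∧ Contact r a v w₁ ∧ Contact r b v w₂ := by
  rw [connections, mem_ofPred_eq]

/-- A quadratic `x ↦ 2 x β + x² γ` without negative values has `β = 0`. -/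
theorem eq_zero_of_forall_quadratic_nonneg {β γ : ℝ}
    (h : ∀ x : ℝ, 0 ≤ 2 * x * β + x ^ 2 * γ) : β = 0 := by
  have h1 := discrim_le_zero (a := γ) (b := 2 * β) (c := 0) fun x => by
    have := h x
    linarith
  rw [discrim] at h1
  nlinarith [sq_nonneg β]

/-- A minimizer among the connections solves the Euler-Lagrange equation. -/
theorem IsExactPair.euler_eq_of_minimal (hE : IsExactPair R M Y L) (p : ℝ[X]) (W : ι → ℝ[X])
    {a b : ℝ} (hab : a < b) {r : ι → ℕ∞} {w₁ w₂ : ℝ → ι → ℝ} {η : ℝ → ν → ℝ}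
    (hη : ContDiff ℝ ∞ η) (hmem : matD M η ∈ connections (behavior R) r a b w₁ w₂)
    (hmin : ∀ v' ∈ connections (behavior R) r a b w₁ w₂,
      energy p W a b (matD M η) (matD M η) ≤ energy p W a b v' v') :
    ∀ t ∈ Icc a b,
      matD (adj M * Matrix.diagonal (fun j => eulerPoly p (W j)) * M) η t = 0 := by
  obtain ⟨hB, ha, hb⟩ := mem_connections.1 hmem
  have hMη := contDiff_matD M hη
  refine euler_eq_of_stationary p W M hab hη fun d hd hflat => ?_
  have hMd := contDiff_matD M hd
  refine eq_zero_of_forall_quadratic_nonneg (γ := energy p W a b (matD M d) (matD M d)) fun x => ?_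
  have h := hmin _ (mem_connections.2
    ⟨behavior_add_smul hB (hE.matD_mem_behavior hd) x,
     ha.add_smul_flat hMη hMd
      (iteratedDeriv_matD_eq_zero M hd fun j k => (hflat j k).1) x,
     hb.add_smul_flat hMη hMd
      (iteratedDeriv_matD_eq_zero M hd fun j k => (hflat j k).2) x⟩)
  rw [energy_add_smul p W a b x hMη hMd] at h
  linarith

theorem vanishTo_of_contact {ι : Type} [Fintype ι] {r : ι → ℕ∞} {a b : ℝ}
    {v v' w₁ w₂ : ℝ → ι → ℝ} (ha : Contact r a v w₁) (ha' : Contact r a v' w₁)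
    (hb : Contact r b v w₂) (hb' : Contact r b v' w₂) (hv : ContDiff ℝ ∞ v)
    (hv' : ContDiff ℝ ∞ v') {j : ι} {n : ℕ} (hn : (n : ℕ∞) ≤ r j + 1) :
    VanishTo a b n (fun t => (v' - v) t j) := by
  intro k hk
  have h1 : (k : ℕ∞) ≤ r j := by
    have h2 : ((k + 1 : ℕ) : ℕ∞) ≤ r j + 1 := le_trans (by exact_mod_cast hk) hn
    rw [Nat.cast_add, Nat.cast_one] at h2
    exact (ENat.add_le_add_iff_right ENat.one_ne_top).1 h2
  exact ⟨ha.iteratedDeriv_sub_eq_zero ha' hv hv' h1, hb.iteratedDeriv_sub_eq_zero hb' hv hv' h1⟩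

/-- If the contact order covers all boundary terms, a solution of the Euler-Lagrange equation is
a minimizer, since the cost is a positive semidefinite quadratic form. -/
theorem IsExactPair.minimal_of_euler_eq (hE : IsExactPair R M Y L) (p : ℝ[X]) {W : ι → ℝ[X]}
    (hW : ∀ j i, 0 ≤ (W j).coeff i) {a b : ℝ} (hab : a < b) {r : ι → ℕ∞}
    (hrW : ∀ j, ((p.natDegree + (W j).natDegree : ℕ) : ℕ∞) ≤ r j + 1)
    (hrR : ∀ i j, ((R i j).natDegree : ℕ∞) ≤ r j + 1)
    {w₁ w₂ : ℝ → ι → ℝ} {η : ℝ → ν → ℝ} (hη : ContDiff ℝ ∞ η)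
    (heq : ∀ t ∈ Icc a b,
      matD (adj M * Matrix.diagonal (fun j => eulerPoly p (W j)) * M) η t = 0)
    (ha : Contact r a (matD M η) w₁) (hb : Contact r b (matD M η) w₂)
    {v : ℝ → ι → ℝ} (hv : v ∈ connections (behavior R) r a b w₁ w₂) :
    energy p W a b (matD M η) (matD M η) ≤ energy p W a b v v := by
  obtain ⟨hB, ha', hb'⟩ := mem_connections.1 hv
  have hMη := contDiff_matD M hη
  have hvs := (mem_behavior.1 hB).1
  have hd : v - matD M η ∈ behavior R := by
    have := behavior_add_smul hB (hE.matD_mem_behavior hη) (-1)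
    rwa [neg_one_smul, ← sub_eq_add_neg] at this
  have h0 := hE.energy_eq_zero p W hab hη heq hd
    (fun j => vanishTo_of_contact ha ha' hb hb' hMη hvs (hrW j))
    (fun i j => vanishTo_of_contact ha ha' hb hb' hMη hvs (hrR i j))
  have h1 := energy_add_smul p W a b 1 hMη (mem_behavior.1 hd).1
  have h2 := energy_self_nonneg p hW hab.le (v - matD M η)
  rw [one_smul, add_sub_cancel, h0] at h1
  linarith

end exact

/-! ### The system `P(D) y = N(D) u` -/

section system

variable {m g : ℕ} {N : Matrix (Fin g) (Fin m) ℝ[X]} {P : Matrix (Fin g) (Fin g) ℝ[X]}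
  {U : Matrix (Fin m ⊕ Fin g) (Fin g ⊕ Fin m) ℝ[X]}

/-- The image matrix `[-U₁₂; U₂₂]`. -/
noncomputable def imageMatrix (U : Matrix (Fin m ⊕ Fin g) (Fin g ⊕ Fin m) ℝ[X]) :
    Matrix (Fin m ⊕ Fin g) (Fin m) ℝ[X] :=
  Matrix.fromRows (-U.toBlocks₁₂) U.toBlocks₂₂

theorem imageTraj_eq_matD (U : Matrix (Fin m ⊕ Fin g) (Fin g ⊕ Fin m) ℝ[X]) (η : ℝ → Fin m → ℝ) :
    imageTraj U η = matD (imageMatrix U) η := by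
  ext t (i | i)
  · have := congrFun (congrFun (matD_neg U.toBlocks₁₂ η) t) i
    exact this.symm
  · rfl

theorem optMatrix_eq (p Wu Wy : ℝ[X]) (U : Matrix (Fin m ⊕ Fin g) (Fin g ⊕ Fin m) ℝ[X]) :
    optMatrix p Wu Wy U = adj (imageMatrix U) *
      Matrix.diagonal
        (fun j : Fin m ⊕ Fin g => eulerPoly p (Sum.elim (fun _ => Wu) (fun _ => Wy) j)) *
        imageMatrix U := by
  have hadj : ∀ (ι : Type) [DecidableEq ι], adj (extOp ι p) = extOp ι (p.comp (-X)) := by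
    intro ι _
    ext1 i j
    by_cases h : i = j
    · simp [adj, extOp, h]
    · simp [adj, extOp, Matrix.one_apply_ne h, Matrix.one_apply_ne' h]
  have hcols : adj (imageMatrix U) =
      Matrix.fromCols (-adj U.toBlocks₁₂) (adj U.toBlocks₂₂) := by
    ext1 i (j | j)
    · simp [adj, imageMatrix]
    · simp [adj, imageMatrix]
  have hdiag : Matrix.diagonal
        (fun j : Fin m ⊕ Fin g => eulerPoly p (Sum.elim (fun _ => Wu) (fun _ => Wy) j)) =
      Matrix.fromBlocks (eulerPoly p Wu • (1 : Matrix (Fin m) (Fin m) ℝ[X])) 0 0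
        (eulerPoly p Wy • (1 : Matrix (Fin g) (Fin g) ℝ[X])) := by
    rw [Matrix.smul_one_eq_diagonal, Matrix.smul_one_eq_diagonal, Matrix.fromBlocks_diagonal]
    congr 1
    ext1 (j | j) <;> rfl
  rw [hcols, hdiag, imageMatrix, Matrix.fromCols_mul_fromBlocks, Matrix.fromCols_mul_fromRows,
    optMatrix, hadj, hadj]
  simp only [extOp, eulerPoly, Matrix.mul_zero, add_zero, zero_add, Matrix.mul_smul,
    Matrix.smul_mul, Matrix.mul_one, Matrix.neg_mul, Matrix.mul_neg, neg_neg,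
    smul_neg, smul_smul]
  congr 2 <;> ring

/-- With `V = U⁻¹`, the equation `[N P] U = [I 0]` says that `[N P]` is the upper block row of
`V`; the blocks of `U V = 1` give the rest, after the sign change of the rows for `u`. -/
theorem IsReducing.exists_isExactPair (hU : IsReducing N P U) :
    ∃ Y L, IsExactPair (sysMatrix N P) (imageMatrix U) Y L := by
  obtain ⟨⟨V, hUV, -⟩, hNP⟩ := hU
  have hV : Matrix.fromCols N P = 
      Matrix.fromCols (1 : Matrix (Fin g) (Fin g) ℝ[X]) (0 : Matrix (Fin g) (Fin m) ℝ[X]) * V := by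
    rw [← hNP, Matrix.mul_assoc, hUV, Matrix.mul_one]
  have hV' : V = Matrix.fromBlocks N P V.toBlocks₂₁ V.toBlocks₂₂ := by
    rw [← Matrix.fromBlocks_toBlocks V, Matrix.fromCols_mul_fromBlocks] at hV
    simp only [Matrix.one_mul, Matrix.zero_mul, add_zero] at hV
    obtain ⟨h1, h2⟩ := Matrix.fromCols_ext_iff _ _ _ _ |>.1 hV
    rw [h1, h2, Matrix.fromBlocks_toBlocks]
  have hUV' := hUV
  rw [hV', ← Matrix.fromBlocks_toBlocks U, Matrix.fromBlocks_multiply, ← Matrix.fromBlocks_one,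
    Matrix.fromBlocks_inj] at hUV'
  have hNP' := hNP
  rw [← Matrix.fromBlocks_toBlocks U, Matrix.fromCols_mul_fromBlocks] at hNP'
  obtain ⟨-, hz⟩ := Matrix.fromCols_ext_iff _ _ _ _ |>.1 hNP'
  obtain ⟨h11, h12, h21, h22⟩ := hUV'
  refine ⟨Matrix.fromRows (-U.toBlocks₁₁) U.toBlocks₂₁,
    Matrix.fromCols (-V.toBlocks₂₁) V.toBlocks₂₂, ?_, ?_⟩
  · rw [sysMatrix, imageMatrix, Matrix.fromCols_mul_fromRows, Matrix.neg_mul, Matrix.mul_neg,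
      neg_neg, hz]
  · rw [sysMatrix, imageMatrix, Matrix.fromRows_mul_fromCols, Matrix.fromRows_mul_fromCols,
      Matrix.fromBlocks_add, ← Matrix.fromBlocks_one]
    simp only [Matrix.neg_mul, Matrix.mul_neg, neg_neg, ← neg_add]
    rw [h11, h12, h21, h22, neg_zero, neg_zero]

/-- The minimizer of a raccordation solves the optimality equations. -/
theorem exists_euler_of_minimal (p Wu Wy : ℝ[X]) {a b : ℝ} (hab : a < b) (hU : IsReducing N P U)
    {r : Fin m ⊕ Fin g → ℕ∞} {w₁ w₂ v : ℝ → Fin m ⊕ Fin g → ℝ}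
    (hv : v ∈ connections (behavior (sysMatrix N P)) r a b w₁ w₂)
    (hmin : ∀ v' ∈ connections (behavior (sysMatrix N P)) r a b w₁ w₂,
      cost p Wu Wy a b v ≤ cost p Wu Wy a b v') :
    ∃ η : ℝ → Fin m → ℝ, ContDiff ℝ ∞ η ∧ (∀ t ∈ Icc a b, matD (optMatrix p Wu Wy U) η t = 0) ∧
      v = imageTraj U η := by
  obtain ⟨Y, L, hE⟩ := hU.exists_isExactPair
  have hvB := (mem_connections.1 hv).1
  have hvs := (mem_behavior.1 hvB).1
  have hvη := hE.eq_matD_of_mem hvB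
  have hη := contDiff_matD L hvs
  refine ⟨matD L v, hη, ?_, by rw [imageTraj_eq_matD]; exact hvη⟩
  rw [optMatrix_eq]
  refine hE.euler_eq_of_minimal p _ hab hη (hvη ▸ hv) fun v' hv' => ?_
  rw [← hvη, ← cost_eq_energy p Wu Wy a b hvs,
    ← cost_eq_energy p Wu Wy a b (mem_behavior.1 (mem_connections.1 hv').1).1]
  exact hmin v' hv'

/-- With contact orders that cover all boundary terms, a solution of the optimality equations with
the right contact is a connection of minimal cost. -/
theorem connection_and_cost_le_of_euler (p : ℝ[X]) {Wu Wy : ℝ[X]} (hWu : ∀ i, 0 ≤ Wu.coeff i)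
    (hWy : ∀ i, 0 ≤ Wy.coeff i) {a b : ℝ} (hab : a < b) (hU : IsReducing N P U)
    {r : Fin m ⊕ Fin g → ℕ∞}
    (hru : ∀ j, ((p.natDegree + Wu.natDegree : ℕ) : ℕ∞) ≤ r (Sum.inl j) + 1)
    (hry : ∀ j, ((p.natDegree + Wy.natDegree : ℕ) : ℕ∞) ≤ r (Sum.inr j) + 1)
    (hrN : ∀ i j, ((N i j).natDegree : ℕ∞) ≤ r (Sum.inl j) + 1)
    (hrP : ∀ i j, ((P i j).natDegree : ℕ∞) ≤ r (Sum.inr j) + 1)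
    {w₁ w₂ : ℝ → Fin m ⊕ Fin g → ℝ} {η : ℝ → Fin m → ℝ} (hη : ContDiff ℝ ∞ η)
    (heq : ∀ t ∈ Icc a b, matD (optMatrix p Wu Wy U) η t = 0)
    (ha : Contact r a (imageTraj U η) w₁) (hb : Contact r b (imageTraj U η) w₂) :
    imageTraj U η ∈ connections (behavior (sysMatrix N P)) r a b w₁ w₂ ∧
      ∀ v' ∈ connections (behavior (sysMatrix N P)) r a b w₁ w₂,
        cost p Wu Wy a b (imageTraj U η) ≤ cost p Wu Wy a b v' := by
  obtain ⟨Y, L, hE⟩ := hU.exists_isExactPair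
  rw [imageTraj_eq_matD] at *
  rw [optMatrix_eq] at heq
  have hB := hE.matD_mem_behavior hη
  refine ⟨mem_connections.2 ⟨hB, ha, hb⟩, fun v' hv' => ?_⟩
  rw [cost_eq_energy p Wu Wy a b (mem_behavior.1 hB).1,
    cost_eq_energy p Wu Wy a b (mem_behavior.1 (mem_connections.1 hv').1).1]
  refine hE.minimal_of_euler_eq p ?_ hab ?_ ?_ hη heq ha hb hv'
  · rintro (j | j)
    · exact hWu
    · exact hWy
  · rintro (j | j)
    · exact hru j
    · exact hry j
  · rintro i (j | j)
    · simpa [sysMatrix] using hrN i j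
    · simpa [sysMatrix] using hrP i j

end system

/-! ### Scalar linear differential equations -/

/-- Uniqueness for the scalar equation `q(D) ψ = 0`, by passing to the companion system. -/
theorem eq_zero_of_polyD_eq_zero {q : ℝ[X]} (hq : q ≠ 0) {ψ : ℝ → ℝ} (hψ : ContDiff ℝ ∞ ψ)
    (h : polyD q ψ = 0) {c : ℝ} (hc : ∀ k, iteratedDeriv k ψ c = 0) : ψ = 0 := by
  have hlead : q.leadingCoeff ≠ 0 := leadingCoeff_ne_zero.2 hq
  have hsolve : ∀ t, iteratedDeriv q.natDegree ψ t =
      -(q.leadingCoeff)⁻¹ * ∑ j : Fin q.natDegree, q.coeff j * iteratedDeriv j ψ t := by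
    intro t
    have h1 := congrFun h t
    rw [polyD, Polynomial.sum_over_range _ fun _ => zero_mul _, Finset.sum_range_succ,
      Pi.zero_apply, coeff_natDegree,
      ← Fin.sum_univ_eq_sum_range fun j => q.coeff j * iteratedDeriv j ψ t] at h1
    field_simp
    linarith
  set n := q.natDegree with hn
  have hder : ∀ k t, HasDerivAt (iteratedDeriv k ψ) (iteratedDeriv (k + 1) ψ t) t := by
    intro k t
    rw [iteratedDeriv_succ]
    exact ((contDiff_infty_iff_deriv.1 (contDiff_iteratedDeriv hψ k)).1 t).hasDerivAt
  let A : (Fin n → ℝ) →ₗ[ℝ] (Fin n → ℝ) := LinearMap.pi fun k =>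
    if hk : (k : ℕ) + 1 < n then LinearMap.proj ⟨k + 1, hk⟩
    else -(q.leadingCoeff)⁻¹ • ∑ j : Fin n, q.coeff j • LinearMap.proj j
  let x : ℝ → Fin n → ℝ := fun t k => iteratedDeriv k ψ t
  have hx : ∀ t, HasDerivAt x (A.toContinuousLinearMap (x t)) t := by
    intro t
    refine hasDerivAt_pi.2 fun k => ?_
    have h1 : A.toContinuousLinearMap (x t) k = iteratedDeriv (k + 1) ψ t := by
      by_cases hk : (k : ℕ) + 1 < n
      · simp [A, x, hk]
      · have hkn : (k : ℕ) + 1 = n := by omega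
        rw [hkn, hsolve t]
        simp [A, x, hk]
    rw [h1]
    exact hder k t
  have hx0 : x = fun _ => 0 := by
    refine ODE_solution_unique_univ (v := fun _ => A.toContinuousLinearMap)
      (s := fun _ => univ) (t₀ := c) (K := ‖A.toContinuousLinearMap‖₊)
      (fun _ => A.toContinuousLinearMap.lipschitz.lipschitzOnWith)
      (fun t => ⟨hx t, mem_univ _⟩) (fun t => ⟨?_, mem_univ _⟩) ?_
    · rw [map_zero]
      exact hasDerivAt_const t 0
    · ext k
      exact hc k
  ext t
  rcases Nat.eq_zero_or_pos n with h0 | hpos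
  · have h1 := hsolve t
    have h2 : ∑ j : Fin n, q.coeff j * iteratedDeriv j ψ t = 0 :=
      Finset.sum_eq_zero fun j _ => absurd j.2 (by omega)
    rw [h2, h0] at h1
    simpa using h1
  · simpa [x] using congrFun (congrFun hx0 t) ⟨0, hpos⟩

theorem iteratedDeriv_re_exp (z : ℂ) (k : ℕ) :
    iteratedDeriv k (fun t : ℝ => (Complex.exp (z * t)).re) =
      fun t : ℝ => (z ^ k * Complex.exp (z * t)).re := by
  induction k with
  | zero => simp
  | succ k ih =>
    rw [iteratedDeriv_succ, ih]
    ext t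
    have h1 : HasDerivAt (fun s : ℂ => z ^ k * Complex.exp (z * s))
        (z ^ k * (Complex.exp (z * t) * (z * 1))) (t : ℂ) :=
      (((hasDerivAt_id (t : ℂ)).const_mul z).cexp).const_mul (z ^ k)
    rw [h1.real_of_complex.deriv]
    congr 1
    ring

theorem contDiff_re_exp (z : ℂ) : ContDiff ℝ ∞ (fun t : ℝ => (Complex.exp (z * t)).re) :=
  Complex.reCLM.contDiff.comp (contDiff_const.mul Complex.ofRealCLM.contDiff).cexp

theorem polyD_re_exp {q : ℝ[X]} {z : ℂ} (hz : aeval z q = 0) :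
    polyD q (fun t : ℝ => (Complex.exp (z * t)).re) = 0 := by
  ext t
  have h : ((aeval z q : ℂ) * Complex.exp (z * t)).re = 0 := by rw [hz, zero_mul, Complex.zero_re]
  rw [aeval_def, eval₂_eq_sum, Polynomial.sum, Finset.sum_mul, Complex.re_sum] at h
  rw [polyD, Polynomial.sum, Pi.zero_apply, ← h]
  refine Finset.sum_congr rfl fun k _ => ?_
  rw [iteratedDeriv_re_exp, mul_assoc]
  simp

/-! ### Unimodular completion -/

theorem behavior_subset_of_eq_mul {κ κ' ι : Type} [Fintype κ'] [Fintype ι]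
    {R : Matrix κ ι ℝ[X]} {E : Matrix κ' ι ℝ[X]} {A : Matrix κ κ' ℝ[X]} (h : R = A * E) :
    behavior E ⊆ behavior R := by
  intro w hw
  obtain ⟨hs, h0⟩ := mem_behavior.1 hw
  refine mem_behavior.2 ⟨hs, fun t => ?_⟩
  have h1 : matD E w = fun _ => 0 := funext h0
  rw [h, matD_mul _ _ hs, h1, matD_zero_fun]
  rfl

section completion

variable {ι : Type} [Fintype ι] [DecidableEq ι]

/-- A controllable behavior has no nontrivial elementary divisors: for a root `z` of `aᵢ` there is
a trajectory with `i`-th coordinate `Re e^{zt}`, and steering it to zero would contradict the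
uniqueness of solutions of the autonomous equation `aᵢ(D) ψ = 0`. -/
theorem isUnit_of_isControllable {κ : Type} [Fintype κ] [DecidableEq κ] {a : κ → ℝ[X]}
    (ha : ∀ i, a i ≠ 0) {f : κ → ι} (hf : Function.Injective f) {M M' : Matrix ι ι ℝ[X]}
    (hM : M * M' = 1)
    (hctr : IsControllable (behavior (Matrix.diagonal a * M.submatrix f id))) (i : κ) :
    IsUnit (a i) := by
  by_contra hu
  have hdeg : (a i).degree ≠ 0 := fun h => hu (isUnit_iff_degree_eq_zero.2 h)
  obtain ⟨z, hz⟩ := IsAlgClosed.exists_aeval_eq_zero ℂ (a i) hdeg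
  set φ : ℝ → ℝ := fun t => (Complex.exp (z * t)).re with hφ
  have hφs : ContDiff ℝ ∞ φ := contDiff_re_exp z
  -- The `i`-th equation is `aᵢ(D)` applied to the coordinate `f i` of `M(D) w`.
  have hrow : ∀ {w : ℝ → ι → ℝ}, ContDiff ℝ ∞ w → ∀ t k,
      matD (Matrix.diagonal a * M.submatrix f id) w t k =
        polyD (a k) (fun s => matD M w s (f k)) t := by
    intro w hw t k
    rw [matD_mul _ _ hw, matD_diagonal]
    rfl
  set e : ℝ → ι → ℝ := fun t => Pi.single (f i) (φ t) with he
  have hes : ContDiff ℝ ∞ e := by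
    refine contDiff_pi.2 fun j => ?_
    by_cases hj : j = f i
    · subst hj
      simpa [he] using hφs
    · simpa [he, Pi.single_eq_of_ne hj] using contDiff_const
  have hws := contDiff_matD M' hes
  have hMw : matD M (matD M' e) = e := by rw [← matD_mul _ _ hes, hM, matD_one]
  have hw : matD M' e ∈ behavior (Matrix.diagonal a * M.submatrix f id) := by
    refine mem_behavior.2 ⟨hws, fun t => ?_⟩
    ext k
    rw [hrow hws, hMw]
    by_cases hk : k = i
    · subst hk
      simpa [he] using congrFun (polyD_re_exp hz) t
    · have h1 : (fun s => e s (f k)) = fun _ => 0 := by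
        ext s
        exact Pi.single_eq_of_ne (fun h => hk (hf h)) _
      rw [h1, polyD_zero_fun]
      rfl
  have h0 : (fun _ => 0 : ℝ → ι → ℝ) ∈ behavior (Matrix.diagonal a * M.submatrix f id) :=
    mem_behavior.2 ⟨contDiff_const, fun t => by rw [matD_zero_fun]; rfl⟩
  obtain ⟨τ, -, w, hwB, hw1, hw2⟩ := hctr _ hw _ h0
  obtain ⟨hwsm, hw0⟩ := mem_behavior.1 hwB
  set ψ : ℝ → ℝ := fun s => matD M w s (f i) with hψ
  have hψs : ContDiff ℝ ∞ ψ := contDiff_comp (contDiff_matD M hwsm) (f i)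
  have hψ0 : ψ = 0 := by
    refine eq_zero_of_polyD_eq_zero (ha i) hψs ?_ (c := τ)
      (iteratedDeriv_eq_zero_of_eqOn_Ioi hψs fun t ht => ?_)
    · ext t
      rw [← hrow hwsm, hw0]
      rfl
    · have h1 : w =ᶠ[nhds t] fun _ => 0 := by
        filter_upwards [isOpen_Ioi.mem_nhds ht] with s hs using hw2 s (le_of_lt hs)
      rw [hψ]
      beta_reduce
      rw [matD_congr M h1, matD_zero_fun]
      rfl
  have hφ0 : φ 0 = 0 := by
    have h1 := iteratedDeriv_eq_zero_of_eqOn_Iio hφs (a := 0) (fun t ht => ?_) 0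
    · simpa using h1
    · have h2 : w =ᶠ[nhds t] matD M' e := by
        filter_upwards [isOpen_Iio.mem_nhds ht] with s hs using hw1 s (le_of_lt hs)
      have h3 : ψ t = e t (f i) := by
        rw [hψ]
        beta_reduce
        rw [matD_congr M h2, hMw]
      rw [hψ0] at h3
      simpa [he] using h3.symm
  simp [hφ] at hφ0

/-- The Smith normal form of the row module of a minimal representation of a controllable
behavior: up to unimodular factors `A`, `M` and units `a`, the matrix consists of `g` distinct
rows of the identity. -/
theorem exists_smith_of_minimal_of_controllable {g : ℕ} {R : Matrix (Fin g) ι ℝ[X]}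
    (hmin : IsMinimalRep R) (hctr : IsControllable (behavior R)) :
    ∃ (a : Fin g → ℝ[X]) (f : Fin g ↪ ι) (M M' : Matrix ι ι ℝ[X])
        (A A' : Matrix (Fin g) (Fin g) ℝ[X]),
      (∀ i, IsUnit (a i)) ∧ M * M' = 1 ∧ A * A' = 1 ∧
        R = A * (Matrix.diagonal a * M.submatrix f id) := by
  obtain ⟨n, bM, bN, f, a, hsnf⟩ := Submodule.smithNormalForm (Pi.basisFun ℝ[X] ι)
    (Submodule.span ℝ[X] (range fun i => R i))
  set M : Matrix ι ι ℝ[X] := Matrix.of fun k => bM k with hM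
  set M' : Matrix ι ι ℝ[X] := (bM.toMatrix (Pi.basisFun ℝ[X] ι)).transpose
  have hMM' : M * M' = 1 := by
    have h1 : M = ((Pi.basisFun ℝ[X] ι).toMatrix bM).transpose := by
      ext1 i j
      simp [hM, Module.Basis.toMatrix_apply]
    rw [h1, ← Matrix.transpose_mul, Module.Basis.toMatrix_mul_toMatrix_flip,
      Matrix.transpose_one]
  set E : Matrix (Fin n) ι ℝ[X] := Matrix.diagonal a * M.submatrix f id with hE
  have hErow : ∀ i, (bN i : ι → ℝ[X]) = E i := by
    intro i
    ext1 j
    rw [hsnf, hE, Matrix.diagonal_mul]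
    rfl
  have hRmem : ∀ i, R i ∈ Submodule.span ℝ[X] (range fun i => R i) :=
    fun i => Submodule.subset_span ⟨i, rfl⟩
  obtain ⟨A, hA⟩ : ∃ A : Matrix (Fin g) (Fin n) ℝ[X], R = A * E := by
    refine ⟨Matrix.of fun i k => bN.repr ⟨R i, hRmem i⟩ k, ?_⟩
    ext1 i j
    have h1 := congrArg (Subtype.val) (bN.sum_repr ⟨R i, hRmem i⟩)
    rw [Submodule.coe_sum] at h1
    have h2 := congrFun h1 j
    rw [Finset.sum_apply] at h2
    rw [Matrix.mul_apply]
    refine h2.symm.trans (Finset.sum_congr rfl fun k _ => ?_)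
    rw [Submodule.coe_smul, Pi.smul_apply, hErow]
    rfl
  obtain ⟨A', hA'⟩ : ∃ A' : Matrix (Fin n) (Fin g) ℝ[X], E = A' * R := by
    have h1 := fun i => (Submodule.mem_span_range_iff_exists_fun ℝ[X]).1 (bN i).2
    choose c hc using h1
    refine ⟨Matrix.of c, ?_⟩
    ext1 i j
    rw [← hErow, ← hc i, Finset.sum_apply, Matrix.mul_apply]
    rfl
  have hbeh : behavior E = behavior R :=
    (behavior_subset_of_eq_mul hA).antisymm (behavior_subset_of_eq_mul hA')
  have hng : n ≤ g := by
    have h1 := finrank_range_le_card (R := ℝ[X]) (fun i => R i)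
    rw [Set.finrank, Module.finrank_eq_card_basis bN] at h1
    simpa using h1
  have hgn : g ≤ n := by simpa using hmin n E hbeh
  obtain rfl : n = g := le_antisymm hng hgn
  have ha : ∀ i, a i ≠ 0 := by
    intro i h0
    have h1 := hsnf i
    rw [h0, zero_smul] at h1
    exact bN.ne_zero i (Subtype.ext h1)
  have hau := isUnit_of_isControllable ha f.injective hMM' (by rw [← hE, hbeh]; exact hctr)
  refine ⟨a, f, M, M', A, A', hau, hMM', ?_, hA⟩
  choose a' ha' using fun i => (hau i).exists_right_inv
  -- `E` has a right inverse, so that `E = A' A E` gives `A' A = 1`.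
  have hsub : M.submatrix f id * M'.submatrix id f = 1 := by
    rw [← Matrix.submatrix_mul M M' f id f Function.bijective_id, hMM',
      Matrix.submatrix_one_embedding]
  have hEr : E * (M'.submatrix id f * Matrix.diagonal a') = 1 := by
    rw [hE, Matrix.mul_assoc, ← Matrix.mul_assoc (M.submatrix f id), hsub, Matrix.one_mul,
      Matrix.diagonal_mul_diagonal]
    simp only [ha', Matrix.diagonal_one]
  have h1 : A' * A * E = E := by rw [Matrix.mul_assoc, ← hA, ← hA']
  have h2 : A' * A = 1 := by
    have h3 := congrArg (· * (M'.submatrix id f * Matrix.diagonal a')) h1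
    simp only [Matrix.mul_assoc, hEr, Matrix.mul_one] at h3
    exact h3
  exact mul_eq_one_comm.1 h2

end completion

theorem exists_equiv_extending {m g : ℕ} (f : Fin g ↪ Fin m ⊕ Fin g) :
    ∃ σ : Fin g ⊕ Fin m ≃ Fin m ⊕ Fin g, ∀ i, σ (Sum.inl i) = f i := by
  classical
  have hcard : Fintype.card ((range f)ᶜ : Set (Fin m ⊕ Fin g)) = m := by
    rw [Fintype.card_compl_set, Set.card_range_of_injective f.injective]
    simp
  refine ⟨((Equiv.ofInjective f f.injective).sumCongr
    (Fintype.equivFinOfCardEq hcard).symm).trans (Equiv.Set.sumCompl (range f)), fun i => ?_⟩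
  simp

theorem exists_isReducing {m g : ℕ} {N : Matrix (Fin g) (Fin m) ℝ[X]}
    {P : Matrix (Fin g) (Fin g) ℝ[X]} (hmin : IsMinimalRep (sysMatrix N P))
    (hctr : IsControllable (behavior (sysMatrix N P))) :
    ∃ U : Matrix (Fin m ⊕ Fin g) (Fin g ⊕ Fin m) ℝ[X], IsReducing N P U := by
  obtain ⟨a, f, M, M', A, A', hau, hMM', hAA', hR⟩ :=
    exists_smith_of_minimal_of_controllable hmin hctr
  obtain ⟨σ, hσ⟩ := exists_equiv_extending f
  choose a' ha' using fun i => (hau i).exists_right_inv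
  -- `V` has the upper block row `[-N P]`, and `T` changes the sign of the input columns.
  let V : Matrix (Fin g ⊕ Fin m) (Fin m ⊕ Fin g) ℝ[X] :=
    Matrix.fromBlocks (A * Matrix.diagonal a) 0 0 (1 : Matrix (Fin m) (Fin m) ℝ[X]) *
      M.submatrix σ id
  let V' : Matrix (Fin m ⊕ Fin g) (Fin g ⊕ Fin m) ℝ[X] :=
    M'.submatrix id σ *
      Matrix.fromBlocks (Matrix.diagonal a' * A') 0 0 (1 : Matrix (Fin m) (Fin m) ℝ[X])
  let T : Matrix (Fin m ⊕ Fin g) (Fin m ⊕ Fin g) ℝ[X] := Matrix.fromBlocks (-1) 0 0 1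
  have hTT : T * T = 1 := by
    simp [T, Matrix.fromBlocks_multiply]
  have hVV' : V * V' = 1 := by
    have h1 : M.submatrix σ id * M'.submatrix id σ = 1 := by
      rw [← Matrix.submatrix_mul M M' σ id σ Function.bijective_id, hMM',
        Matrix.submatrix_one_equiv]
    have h2 : A * Matrix.diagonal a * (Matrix.diagonal a' * A') = 1 := by
      rw [Matrix.mul_assoc, ← Matrix.mul_assoc (Matrix.diagonal a),
        Matrix.diagonal_mul_diagonal]
      simp only [ha', Matrix.diagonal_one, Matrix.one_mul, hAA']
    simp only [V, V']
    rw [Matrix.mul_assoc, ← Matrix.mul_assoc (M.submatrix σ id), h1, Matrix.one_mul,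
      Matrix.fromBlocks_multiply, h2]
    simp
  have hV'V : V' * V = 1 := by
    exact (Matrix.mul_eq_one_comm_of_equiv σ).1 hVV'
  have hRV : sysMatrix N P =
      Matrix.fromCols (1 : Matrix (Fin g) (Fin g) ℝ[X]) (0 : Matrix (Fin g) (Fin m) ℝ[X]) * V := by
    have h1 : M.submatrix σ id =
        Matrix.fromRows (M.submatrix f id) (M.submatrix (fun j => σ (Sum.inr j)) id) := by
      ext1 (i | i) j
      · simp [hσ]
      · simp
    simp only [V]
    rw [← Matrix.mul_assoc, Matrix.fromCols_mul_fromBlocks, h1, Matrix.fromCols_mul_fromRows, hR]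
    simp [Matrix.mul_assoc]
  have hNP : Matrix.fromCols N P = sysMatrix N P * T := by
    simp [sysMatrix, T, Matrix.fromCols_mul_fromBlocks]
  refine ⟨T * V', ⟨V * T, ?_, ?_⟩, ?_⟩
  · rw [Matrix.mul_assoc, ← Matrix.mul_assoc V', hV'V, Matrix.one_mul, hTT]
  · rw [Matrix.mul_assoc, ← Matrix.mul_assoc T, hTT, Matrix.one_mul, hVV']
  · rw [hNP, Matrix.mul_assoc, ← Matrix.mul_assoc T, hTT, Matrix.one_mul, hRV, Matrix.mul_assoc,
      hVV', Matrix.mul_one]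

end Gluskabi

theorem theorem2 {m g : ℕ}
    (N : Matrix (Fin g) (Fin m) ℝ[X]) (P : Matrix (Fin g) (Fin g) ℝ[X])
    (hmin : IsMinimalRep (sysMatrix N P))
    (hctr : IsControllable (behavior (sysMatrix N P)))
    (p Wu Wy : ℝ[X]) (hWu : ∀ i, 0 ≤ Wu.coeff i) (hWy : ∀ i, 0 ≤ Wy.coeff i)
    (a b : ℝ) (hab : a < b) :
    (∃ U : Matrix (Fin m ⊕ Fin g) (Fin g ⊕ Fin m) ℝ[X], IsReducing N P U) ∧
    ∀ U : Matrix (Fin m ⊕ Fin g) (Fin g ⊕ Fin m) ℝ[X], IsReducing N P U →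
      -- every element of the Gluskabi extension satisfies the equations on `[a, b]`
      (∀ r : Fin m ⊕ Fin g → ℕ∞,
        ∀ w ∈ gluskabiExtension (behavior (sysMatrix N P))
            (typeOf (behavior (sysMatrix N P)) p) (cost p Wu Wy a b) r a b,
          ∃ η : ℝ → Fin m → ℝ, ContDiff ℝ ∞ η ∧
            (∀ t ∈ Icc a b, matD (optMatrix p Wu Wy U) η t = 0) ∧
            EqOn w (imageTraj U η) (Icc a b)) ∧
      -- with enough boundary conditions, the equations characterize the optimal connections
      (∀ r : Fin m ⊕ Fin g → ℕ∞,
        (∀ j, ((p.natDegree + Wu.natDegree : ℕ) : ℕ∞) ≤ r (Sum.inl j) + 1) →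
        (∀ j, ((p.natDegree + Wy.natDegree : ℕ) : ℕ∞) ≤ r (Sum.inr j) + 1) →
        (∀ i j, ((N i j).natDegree : ℕ∞) ≤ r (Sum.inl j) + 1) →
        (∀ i j, ((P i j).natDegree : ℕ∞) ≤ r (Sum.inr j) + 1) →
        ∀ w₁ ∈ typeOf (behavior (sysMatrix N P)) p,
        ∀ w₂ ∈ typeOf (behavior (sysMatrix N P)) p,
        ∀ w : ℝ → (Fin m ⊕ Fin g) → ℝ,
          w ∈ raccordations (behavior (sysMatrix N P)) (cost p Wu Wy a b) r a b w₁ w₂ ↔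
            EqOn w w₁ (Iic a) ∧ EqOn w w₂ (Ici b) ∧
            ∃ η : ℝ → Fin m → ℝ, ContDiff ℝ ∞ η ∧
              (∀ t ∈ Icc a b, matD (optMatrix p Wu Wy U) η t = 0) ∧
              Contact r a (imageTraj U η) w₁ ∧ Contact r b (imageTraj U η) w₂ ∧
              EqOn w (imageTraj U η) (Icc a b)) := by
  refine ⟨exists_isReducing hmin hctr, fun U hU => ⟨?_, ?_⟩⟩
  · intro r w hw
    rw [gluskabiExtension, mem_ofPred_eq] at hw
    obtain ⟨w₁, -, w₂, -, hw⟩ := hw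
    rw [raccordations, mem_ofPred_eq] at hw
    obtain ⟨-, -, v, hv, hwv, hvmin⟩ := hw
    obtain ⟨η, hη, heq, rfl⟩ := exists_euler_of_minimal p Wu Wy hab hU hv hvmin
    exact ⟨η, hη, heq, hwv⟩
  · intro r hru hry hrN hrP w₁ _ w₂ _ w
    rw [raccordations, mem_ofPred_eq]
    refine and_congr_right fun _ => and_congr_right fun _ => ⟨?_, ?_⟩
    · rintro ⟨v, hv, hwv, hvmin⟩
      obtain ⟨η, hη, heq, rfl⟩ := exists_euler_of_minimal p Wu Wy hab hU hv hvmin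
      obtain ⟨-, ha, hb⟩ := mem_connections.1 hv
      exact ⟨η, hη, heq, ha, hb, hwv⟩
    · rintro ⟨η, hη, heq, ha, hb, hwv⟩
      obtain ⟨hc, hle⟩ := connection_and_cost_le_of_euler p hWu hWy hab hU hru hry hrN hrP hη heq
        ha hb
      exact ⟨_, hc, hwv, hle⟩
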